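/- Let $m\ge 2$, $n=2^m-1$, and let $h_2(X)\in\mathbb{Z}_2[X]$ be a primitive irreducible polynomial of degree $m$ (irreducible, with a root of multiplicative order $n$). Let $h(X)\in\mathbb{Z}_4[X]$ be its Hensel lift: the unique monic polynomial of degree $m$ with $h\equiv h_2 \pmod 2$ and $h(X)\mid X^n-1$ in $\mathbb{Z}_4[X]$. Then $(X-1)h(X)$ divides $X^n-1$; let $g(X)$ be the reciprocal polynomial of $(X^n-1)/((X-1)h(X))$. Let $D$ be the cyclic code of length $n$ over $\mathbb{Z}_4$ generated by $g(X)$, extended by an overall parity check (one more coordinate, which makes the sum of all coordinates $0$). Then $D$ is a quaternary linear code of length $2^m$ containing $4^{m+1}$ words. Let $\phi:\mathbb{Z}_4^N\to\mathbb{Z}_2^{2N}$, $\phi(a)=(\beta(a),\gamma(a))$, be the Gray map, where, coordinatewise, $\beta$ maps $0,1,2,3$ to $0,0,1,1$ and $\gamma$ maps $0,1,2,3$ to $0,1,1,0$. If $m\ge 3$ is odd, then the binary code $K=\phi(D)$ is the Kerdock code of length $2^{m+1}$; it contains $2^{2m+2}$ words and has minimal distance $2^m-2^{(m-1)/2}$.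 Here the Kerdock code of length $2^{m+1}$ is the following set of Boolean functions on $F\times\mathbb{F}_2$, where $F$ is the field with $2^m$ elements, $\mathrm{tr}$ its absolute trace to $\mathbb{F}_2$ and $Q(x)=\sum_{j=1}^{(m-1)/2}\mathrm{tr}(x^{1+2^j})$: the union, over all $\pi\in F$, of the cosets $q_\pi+\mathrm{RM}(1,m+1)$, where $q_\pi(x,e)=Q(\pi x)+e\,\mathrm{tr}(\pi x)$ and $\mathrm{RM}(1,m+1)$ consists of all functions $(x,e)\mapsto \mathrm{tr}(\eta x)+Ae+B$ with $\eta\in F$ and $A,B\in\mathbb{F}_2$. The identification of coordinates is the following. The polynomial $h_2$ has a root in $F$, and for every such root $\theta$ the $t$-th cyclic coordinate ($0\le t<n$) of the left (right) half of $K$ corresponds to the point $(\theta^t,0)$ (respectively $(\theta^t,1)$), and the parity check coordinate of the left (right) half to the point $(0,0)$ (respectively $(0,1)$); this is a bijection of the $2^{m+1}$ coordinates with $F\times\mathbb{F}_2$. -/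

import Mathlib

namespace Z4Code

open Polynomial

/-- A primitive binary polynomial: irreducible, and its root `X mod f` generates the multiplicative
group of the field with `2 ^ deg f` elements, i.e. has multiplicative order `2 ^ deg f - 1`. -/
def IsPrimitiveBinary (f : (ZMod 2)[X]) : Prop :=
  Irreducible f ∧ orderOf (AdjoinRoot.root f) = 2 ^ f.natDegree - 1

/-- `h` is the Hensel lift to `ℤ/4` of the binary polynomial `h₂` of degree `m`: it is monic of
degree `m`, reduces to `h₂` modulo 2, and divides `X ^ n - 1` modulo 4, where `n = 2 ^ m - 1`. -/
def IsHenselLift (m : ℕ) (h₂ : (ZMod 2)[X]) (h : (ZMod 4)[X]) : Prop :=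
  h.Monic ∧ h.natDegree = m ∧ h.map (ZMod.castHom (by norm_num : 2 ∣ 4) (ZMod 2)) = h₂ ∧
    h ∣ X ^ (2 ^ m - 1) - 1

/-- The generator `g`: the reciprocal polynomial of `(X ^ n - 1) / ((X - 1) h)`, `n = 2 ^ m - 1`. -/
noncomputable def generator (m : ℕ) (h : (ZMod 4)[X]) : (ZMod 4)[X] :=
  ((X ^ (2 ^ m - 1) - 1) /ₘ ((X - 1) * h)).reverse

/-- The polynomial `c₀ + c₁ X + ⋯ + cₙ₋₁ X ^ (n - 1)` of a word `c` of length `n`. -/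
noncomputable def wordPoly {R : Type*} [CommRing R] (n : ℕ) : (Fin n → R) →ₗ[R] R[X] :=
  ∑ i : Fin n, (monomial (i : ℕ)).comp (LinearMap.proj i)

/-- The cyclic code of length `n` generated by `g`: the words whose polynomial lies, modulo
`X ^ n - 1`, in the principal ideal of `R[X] / (X ^ n - 1)` generated by `g`. -/
noncomputable def cyclicCode {R : Type*} [CommRing R] (n : ℕ) (g : R[X]) :
    Submodule R (Fin n → R) :=
  ((Ideal.span {g, X ^ n - 1}).restrictScalars R).comap (wordPoly n)

/-- The code `C` extended by an overall parity check: every word receives one more coordinate, at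
the position `none`, which makes the sum of all its coordinates zero. -/
def extendedCode {R : Type*} [CommRing R] {n : ℕ} (C : Submodule R (Fin n → R)) :
    Submodule R (Option (Fin n) → R) where
  carrier := {w | (fun i => w (some i)) ∈ C ∧ ∑ p, w p = 0}
  add_mem' := by
    rintro a b ⟨ha, ha'⟩ ⟨hb, hb'⟩
    exact ⟨C.add_mem ha hb, by simp only [Pi.add_apply, Finset.sum_add_distrib, ha', hb', add_zero]⟩
  zero_mem' := ⟨C.zero_mem, by simp⟩
  smul_mem' := by
    rintro r a ⟨ha, ha'⟩
    exact ⟨C.smul_mem r ha, by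
      simp only [Pi.smul_apply, smul_eq_mul, ← Finset.mul_sum, ha', mul_zero]⟩

/-- The quaternary code `D`: the cyclic code of length `2 ^ m - 1` generated by `g`, extended by an
overall parity check. -/
noncomputable def quaternaryCode (m : ℕ) (h : (ZMod 4)[X]) :
    Submodule (ZMod 4) (Option (Fin (2 ^ m - 1)) → ZMod 4) :=
  extendedCode (cyclicCode (2 ^ m - 1) (generator m h))

/-- `β : 0, 1, 2, 3 ↦ 0, 0, 1, 1`. -/
def β (i : ZMod 4) : ZMod 2 := if i = 2 ∨ i = 3 then 1 else 0

/-- `γ : 0, 1, 2, 3 ↦ 0, 1, 1, 0`. -/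
def γ (i : ZMod 4) : ZMod 2 := if i = 1 ∨ i = 2 then 1 else 0

/-- The Gray map `φ(a) = (β(a), γ(a))`; the left half is indexed by `Sum.inl`, the right half by
`Sum.inr`. -/
def gray {ι : Type*} (a : ι → ZMod 4) : ι ⊕ ι → ZMod 2 :=
  Sum.elim (fun i => β (a i)) (fun i => γ (a i))

/-- The length of a code: the number of coordinates of its words. -/
def codeLength {ι A : Type*} [Fintype ι] (_C : Set (ι → A)) : ℕ := Fintype.card ι

/-- `d` is the minimal distance of the code `C`: the least Hamming distance between two distinct
words of `C`. -/
def IsMinimalDistance {ι A : Type*} [Fintype ι] [DecidableEq A] (C : Set (ι → A)) (d : ℕ) : Prop :=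
  IsLeast {k | ∃ u ∈ C, ∃ v ∈ C, u ≠ v ∧ hammingDist u v = k} d

/-- The trace from a finite field `F` of characteristic 2 to `ℤ/2`. -/
noncomputable def tr {F : Type*} [Field F] [Algebra (ZMod 2) F] (x : F) : ZMod 2 :=
  Algebra.trace (ZMod 2) F x

/-- The first-order Reed-Muller code, as a set of Boolean functions on `F × 𝔽₂`: all affine
functions `(x, e) ↦ tr(η x) + A e + B`. -/
def reedMullerOne (F : Type*) [Field F] [Algebra (ZMod 2) F] : Set (F × ZMod 2 → ZMod 2) :=
  {w | ∃ (η : F) (A B : ZMod 2), ∀ x e, w (x, e) = tr (η * x) + A * e + B}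

/-- The quadratic form `Q(x) = ∑ tr(x ^ (1 + 2 ^ j))`, `1 ≤ j ≤ (m - 1) / 2`. -/
noncomputable def Q {F : Type*} [Field F] [Algebra (ZMod 2) F] (m : ℕ) (x : F) : ZMod 2 :=
  ∑ j ∈ Finset.Icc 1 ((m - 1) / 2), tr (x ^ (1 + 2 ^ j))

/-- The Kerdock code of length `2 ^ (m + 1)`, `m` odd, as a set of Boolean functions on `F × 𝔽₂`,
where `F` is the field with `2 ^ m` elements (`F × {0}` is the left half of the coordinates and
`F × {1}` the right half): the union, over `π` in `F`, of the cosets of the first-order Reed-Muller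
code which contain the quadratic functions with left half `Q(π x)` and right half
`Q(π x) + tr(π x)`. The choice `π = 0` gives the Reed-Muller code itself. -/
def kerdockCode (F : Type*) [Field F] [Algebra (ZMod 2) F] (m : ℕ) :
    Set (F × ZMod 2 → ZMod 2) :=
  {w | ∃ π : F, ∃ r ∈ reedMullerOne F,
    ∀ x e, w (x, e) = Q m (π * x) + e * tr (π * x) + r (x, e)}

/-- The point of `F` at a coordinate of an extended cyclic code of length `n + 1`, with respect to
`θ` in `F`: the cyclic position `t` is `θ ^ t` and the parity check position is `0`. -/
def point {F : Type*} [Field F] (θ : F) {n : ℕ} : Option (Fin n) → F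
  | some t => θ ^ (t : ℕ)
  | none => 0

/-- The same for the binary image: the point of `F × 𝔽₂` at a coordinate of the left or of the
right half. -/
def binaryPoint {F : Type*} [Field F] (θ : F) {n : ℕ} :
    Option (Fin n) ⊕ Option (Fin n) → F × ZMod 2
  | .inl p => (point θ p, 0)
  | .inr p => (point θ p, 1)

/-- The binary image `K = φ(D)` of the quaternary code. -/
noncomputable def binaryCode (m : ℕ) (h : (ZMod 4)[X]) :
    Set (Option (Fin (2 ^ m - 1)) ⊕ Option (Fin (2 ^ m - 1)) → ZMod 2) :=
  gray '' (quaternaryCode m h : Set (Option (Fin (2 ^ m - 1)) → ZMod 4))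

end Z4Code

/-! The ring `R = (ℤ/4)[X]/(h)` is a Galois ring with residue field `F` of order `2 ^ m`. The class
`ξ` of `X` has order `2 ^ m - 1`, the Teichmüller set `{0} ∪ {ξ ^ t}` maps bijectively onto `F`,
every element is `a + 2b` with `a`, `b` Teichmüller, and `ξ ↦ ξ ^ 2` extends to a Frobenius
automorphism, hence to a trace `T : R → ℤ/4`. The words of the quaternary code are exactly `x ↦ T(l
x) + e` on the Teichmüller set. These words lie in the code (`traceWord_mem`), they are distinct
because the trace form is nondegenerate, and there are `4 ^ (m + 1)` of them, which is also an upper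
bound for the size of the code (`card_quaternaryCode_le`). For odd `m`, squaring the sum of
conjugates gives `T(u)² = T(u) + 2 ∑ T(u ^ (1 + 2 ^ d))` (`trace_sq`), so the upper binary digit of
`T(u)` is `Q` of the residue of `u` (`β_trace`). Adding `2T(bx)` and `e` digit by digit turns the
Gray image of a trace word into a Kerdock function (`gray_traceWord`). Since the quaternary code is
linear and the Gray map an isometry, distances are weights of Kerdock functions. For `π ≠ 0` these
are bent, with character sum `± 2 ^ ((m + 1) / 2)`; for `π = 0` they are affine. -/

namespace Z4Code

open Polynomial

/-! ### Cyclic codes: membership criterion and size bound. -/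

section CyclicCodes

variable {k : Type*} [CommRing k]

theorem wordPoly_apply (n : ℕ) (c : Fin n → k) :
    wordPoly n c = ∑ i : Fin n, monomial (i : ℕ) (c i) := by
  simp [wordPoly]

theorem coeff_wordPoly (n : ℕ) (c : Fin n → k) (i : Fin n) : (wordPoly n c).coeff i = c i := by
  simp [wordPoly_apply, coeff_monomial, Fin.val_inj]

theorem degree_wordPoly_lt (n : ℕ) (c : Fin n → k) : (wordPoly n c).degree < n := by
  rw [wordPoly_apply]
  exact mem_degreeLT.1 (Submodule.sum_mem _ fun i _ => monomial_coe_mem_degreeLT i (c i))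

theorem wordPoly_injective_mod [Nontrivial k] {n : ℕ} (hn : n ≠ 0) {c d : Fin n → k}
    (h : (X ^ n - 1 : k[X]) ∣ wordPoly n c - wordPoly n d) : c = d := by
  rw [← map_sub] at h
  have hM : (X ^ n - 1 : k[X]).Monic := monic_X_pow_sub_C 1 hn
  have h0 : wordPoly n (c - d) = 0 := by
    by_contra hne
    refine hM.not_dvd_of_degree_lt hne ?_ h
    have : (X ^ n - 1 : k[X]).degree = n := degree_X_pow_sub_C (Nat.pos_of_ne_zero hn) 1
    rw [this]
    exact degree_wordPoly_lt n _
  funext i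
  have := coeff_wordPoly n (c - d) i
  rw [h0, coeff_zero] at this
  exact (sub_eq_zero.1 this.symm)

theorem reverse_X_pow_sub_one [Nontrivial k] (n : ℕ) :
    (X ^ n - 1 : k[X]).reverse = 1 - X ^ n := by
  have hd : (X ^ n - 1 : k[X]).natDegree = n := natDegree_X_pow_sub_C
  rw [reverse, hd, sub_eq_add_neg, reflect_add]
  have h1 : reflect n (-1 : k[X]) = - X ^ n := by
    simpa only [map_neg, map_one, neg_mul, one_mul] using reflect_C (-1 : k) n
  rw [h1, reflect_monomial, revAt_le le_rfl]
  simp [sub_eq_add_neg]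

/-- Reversal is multiplicative here although `k` may have zero divisors, because the leading
coefficients are 1. Thus `P.reverse` is a check polynomial for the code generated by `q.reverse`. -/
theorem reverse_mul_reverse_of_mul_eq [Nontrivial k] {n : ℕ} (hn : n ≠ 0) {P q : k[X]}
    (hP : P.Monic) (hq : P * q = X ^ n - 1) : P.reverse * q.reverse = 1 - X ^ n := by
  have hM : (X ^ n - 1 : k[X]).Monic := monic_X_pow_sub_C 1 hn
  have hqm : q.Monic := hP.of_mul_monic_left (hq ▸ hM)
  rw [← reverse_mul, hq, reverse_X_pow_sub_one n]
  simp [hP.leadingCoeff, hqm.leadingCoeff]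

theorem mem_cyclicCode_iff {n : ℕ} {g : k[X]} {c : Fin n → k} :
    c ∈ cyclicCode n g ↔ ∃ s t : k[X], wordPoly n c = s * g + t * (X ^ n - 1) := by
  simp only [cyclicCode, Submodule.mem_comap, Submodule.restrictScalars_mem,
    Ideal.mem_span_pair, eq_comm]

theorem mem_cyclicCode_of_dvd [Nontrivial k] {n : ℕ} (hn : n ≠ 0) {P q : k[X]}
    (hP : P.Monic) (hq : P * q = X ^ n - 1) {c : Fin n → k}
    (hc : (X ^ n - 1 : k[X]) ∣ wordPoly n c * P.reverse) : c ∈ cyclicCode n q.reverse := by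
  obtain ⟨s, hs⟩ := hc
  have hr := reverse_mul_reverse_of_mul_eq hn hP hq
  refine mem_cyclicCode_iff.2 ⟨-s, 0, ?_⟩
  have hM : (X ^ n - 1 : k[X]).Monic := monic_X_pow_sub_C 1 hn
  rw [← sub_eq_zero]
  apply hM.isRegular.left
  linear_combination (wordPoly n c) * hr - q.reverse * hs

/-- A multiplier of `q.reverse` matters only modulo `P.reverse`, so one of degree less than
`P.natDegree` represents each word. -/
theorem card_cyclicCode_le [Nontrivial k] [Finite k] {n : ℕ} (hn : n ≠ 0) {P q : k[X]}
    (hP : P.Monic) (hq : P * q = X ^ n - 1) :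
    Nat.card (cyclicCode n q.reverse) ≤ Nat.card k ^ P.natDegree := by
  have hr := reverse_mul_reverse_of_mul_eq hn hP hq
  -- The leading coefficient of `P.reverse` is `P.coeff 0`, whose inverse is `-q.coeff 0`; this
  -- constant makes the divisor monic.
  have h0 : P.coeff 0 * q.coeff 0 = -1 := by
    rw [← mul_coeff_zero, hq]
    simp [coeff_X_pow, hn.symm]
  have hP0 : P.coeff 0 ≠ 0 := by
    intro h
    rw [h, zero_mul] at h0
    exact one_ne_zero (neg_eq_zero.1 h0.symm)
  have htd : P.natTrailingDegree = 0 := natTrailingDegree_eq_zero.2 (Or.inr hP0)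
  have hM : (C (-q.coeff 0) * P.reverse).Monic := by
    apply monic_C_mul_of_mul_leadingCoeff_eq_one
    rw [reverse_leadingCoeff, trailingCoeff, htd]
    linear_combination -h0
  have hMd : (C (-q.coeff 0) * P.reverse).degree ≤ P.natDegree :=
    degree_le_of_natDegree_le
      ((natDegree_C_mul_le _ _).trans (reverse_natDegree_le P))
  have key : ∀ c : cyclicCode n q.reverse, ∃ r : degreeLT k P.natDegree,
      (X ^ n - 1 : k[X]) ∣ wordPoly n c.1 - r.1 * q.reverse := by
    intro c
    obtain ⟨s, t, hst⟩ := mem_cyclicCode_iff.1 c.2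
    refine ⟨⟨s %ₘ (C (-q.coeff 0) * P.reverse), mem_degreeLT.2
      ((degree_modByMonic_lt s hM).trans_le hMd)⟩,
      t - C (-q.coeff 0) * (s /ₘ (C (-q.coeff 0) * P.reverse)), ?_⟩
    have hdm := modByMonic_add_div s (C (-q.coeff 0) * P.reverse)
    linear_combination hst - q.reverse * hdm +
      C (-q.coeff 0) * (s /ₘ (C (-q.coeff 0) * P.reverse)) * hr
  choose r hrr using key
  have hinj : Function.Injective r := by
    intro c d hcd
    apply Subtype.ext
    apply wordPoly_injective_mod hn
    have := dvd_sub (hrr c) (hrr d)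
    rw [hcd] at this
    simpa using this
  have : Finite (degreeLT k P.natDegree) := Finite.of_equiv _ (degreeLTEquiv k _).toEquiv.symm
  calc Nat.card (cyclicCode n q.reverse) ≤ Nat.card (degreeLT k P.natDegree) :=
        Nat.card_le_card_of_injective r hinj
    _ = Nat.card k ^ P.natDegree := by
        rw [Nat.card_congr (degreeLTEquiv k _).toEquiv, Nat.card_fun, Nat.card_fin]

theorem intertwine_aeval {M N : Type*} [AddCommGroup M] [Module k M] [AddCommGroup N] [Module k N]
    (f : M →ₗ[k] N) (S : Module.End k M) (S' : Module.End k N) (h : ∀ x, f (S x) = S' (f x))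
    (p : k[X]) (x : M) : f (aeval S p x) = aeval S' p (f x) := by
  induction p using Polynomial.induction_on' generalizing x with
  | add p q hp hq => simp [hp, hq]
  | monomial i a =>
    have : ∀ i x, f ((S ^ i) x) = (S' ^ i) (f x) := by
      intro i
      induction i with
      | zero => simp
      | succ i ih => intro x; simp [pow_succ, ih, h]
    simp [aeval_monomial, Algebra.algebraMap_eq_smul_one, this]

/-- The map `Ψ r = ∑ T(r b ^ t) x ^ t` turns multiplication by `b` into multiplication by `y = x⁻¹`.
Hence `P(y) Ψ(1) = Ψ(P(b)) = 0`, where `Ψ(1)` is the word and `P(y)` is `P.reverse` at `x` times a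
unit. This inversion is why the generator is a reciprocal polynomial. -/
theorem mem_cyclicCode_of_aeval_eq_zero [Nontrivial k] {n : ℕ} (hn : n ≠ 0) {P q : k[X]}
    (hP : P.Monic) (hq : P * q = X ^ n - 1) {B : Type*} [CommRing B] [Algebra k B] {b : B}
    (hb : b ^ n = 1) (hPb : aeval b P = 0) (T : B →ₗ[k] k) :
    (fun t : Fin n => T (b ^ (t : ℕ))) ∈ cyclicCode n q.reverse := by
  apply mem_cyclicCode_of_dvd hn hP hq
  rw [← AdjoinRoot.mk_eq_zero]
  set x := AdjoinRoot.root (X ^ n - 1 : k[X]) with hx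
  have hxn : x ^ n = 1 := by
    have := AdjoinRoot.eval₂_root (X ^ n - 1 : k[X])
    simpa [sub_eq_zero] using this
  obtain ⟨N, rfl⟩ := Nat.exists_eq_succ_of_ne_zero hn
  have hinv : x * x ^ N = 1 := by rw [← pow_succ']; exact hxn
  let y : AdjoinRoot (X ^ (N + 1) - 1 : k[X]) := x ^ N
  let Ψ : B →ₗ[k] AdjoinRoot (X ^ (N + 1) - 1 : k[X]) :=
    ∑ t ∈ Finset.range (N + 1),
      (LinearMap.toSpanSingleton k _ (x ^ t)).comp (T.comp (LinearMap.mulRight k (b ^ t)))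
  have hΨ : ∀ r, Ψ r = ∑ t ∈ Finset.range (N + 1), T (r * b ^ t) • x ^ t := by
    intro r; simp [Ψ]
  have hshift : ∀ r, Ψ (LinearMap.mulLeft k b r) = LinearMap.mulLeft k y (Ψ r) := by
    intro r
    rw [LinearMap.mulLeft_apply, LinearMap.mulLeft_apply, hΨ, hΨ, Finset.sum_range_succ,
      Finset.sum_range_succ', mul_add, Finset.mul_sum]
    congr 1
    · refine Finset.sum_congr rfl fun t _ => ?_
      rw [mul_smul_comm, pow_succ' x, ← mul_assoc, mul_comm y x, hinv, one_mul]
      congr 2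
      ring
    · rw [mul_smul_comm]
      congr 1
      · congr 1
        rw [pow_zero, mul_one, mul_comm b r, mul_assoc, ← pow_succ', hb, mul_one]
      · simp [y]
  have h0 : aeval y P * Ψ 1 = 0 := by
    have := intertwine_aeval Ψ (LinearMap.mulLeft k b) (LinearMap.mulLeft k y) hshift P 1
    have e1 : aeval (LinearMap.mulLeft k b) P = LinearMap.mulLeft k (aeval b P) :=
      aeval_algHom_apply (Algebra.lmul k B) b P
    have e2 : aeval (LinearMap.mulLeft k y) P = LinearMap.mulLeft k (aeval y P) :=
      aeval_algHom_apply (Algebra.lmul k _) y P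
    rw [e1, e2, hPb] at this
    simpa using this.symm
  have hw : AdjoinRoot.mk (X ^ (N + 1) - 1 : k[X])
      (wordPoly (N + 1) fun t : Fin (N + 1) => T (b ^ (t : ℕ))) = Ψ 1 := by
    rw [hΨ, wordPoly_apply, map_sum, Finset.sum_range]
    refine Finset.sum_congr rfl fun t _ => ?_
    rw [one_mul, ← C_mul_X_pow_eq_monomial, map_mul, map_pow (AdjoinRoot.mk _), AdjoinRoot.mk_C,
      AdjoinRoot.mk_X, Algebra.smul_def]
    rfl
  let _ : Invertible y := ⟨x, hinv, by rw [mul_comm]; exact hinv⟩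
  have hrev : AdjoinRoot.mk (X ^ (N + 1) - 1 : k[X]) P.reverse * y ^ P.natDegree = aeval y P := by
    have := eval₂_reverse_mul_pow (algebraMap k (AdjoinRoot (X ^ (N + 1) - 1 : k[X]))) y P
    rw [aeval_def, ← this, ← AdjoinRoot.aeval_eq, aeval_def]
    rfl
  have hy : IsUnit (y ^ P.natDegree) := (isUnit_of_invertible y).pow _
  rw [map_mul, hw, ← hy.mul_left_eq_zero, mul_assoc, hrev, mul_comm, h0]

theorem card_extendedCode_le [Finite k] {n : ℕ} (C : Submodule k (Fin n → k)) :
    Nat.card (extendedCode C) ≤ Nat.card C := by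
  refine Nat.card_le_card_of_injective
    (fun w : extendedCode C => (⟨fun i => w.1 (some i), w.2.1⟩ : C)) ?_
  intro v w hvw
  have hsome : ∀ i, v.1 (some i) = w.1 (some i) := fun i => congrFun (congrArg Subtype.val hvw) i
  have hv := v.2.2
  have hw := w.2.2
  rw [Fintype.sum_option] at hv hw
  apply Subtype.ext
  funext p
  cases p with
  | some i => exact hsome i
  | none =>
    simp only [hsome] at hv
    exact add_right_cancel (hv.trans hw.symm)

end CyclicCodes

/-! ### Sums over a period of odd length. -/

section PeriodicSums

variable {A : Type*} [CommSemiring A]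

theorem sum_range_shift {m : ℕ} {g : ℕ → A} (hg : ∀ i, g (i + m) = g i) (a : ℕ) :
    ∑ i ∈ Finset.range m, g (i + a) = ∑ i ∈ Finset.range m, g i := by
  induction a with
  | zero => rfl
  | succ a ih =>
    rw [← ih]
    cases m with
    | zero => rfl
    | succ m =>
      rw [Finset.sum_range_succ, Finset.sum_range_succ' (fun i => g (i + a))]
      congr 1
      · refine Finset.sum_congr rfl fun i _ => congrArg g (by ring)
      · rw [← hg (0 + a)]
        exact congrArg g (by ring)

theorem sum_Icc_one_eq_sum_range (k : ℕ) (g : ℕ → A) :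
    ∑ d ∈ Finset.Icc 1 k, g d = ∑ d ∈ Finset.range k, g (d + 1) := by
  induction k with
  | zero => simp
  | succ k ih => rw [Finset.sum_Icc_succ_top (by omega), ih, Finset.sum_range_succ]

/-- Pairing `d` with `2k + 1 - d` leaves only 0 alone, as the period is odd. -/
theorem sum_range_two_mul_add_one (k : ℕ) (P : ℕ → A) :
    ∑ d ∈ Finset.range (2 * k + 1), P d =
      P 0 + ∑ d ∈ Finset.Icc 1 k, (P d + P (2 * k + 1 - d)) := by
  have h2 : ∑ d ∈ Finset.range k, P (k + d + 1) =
      ∑ d ∈ Finset.range k, P (2 * k + 1 - (d + 1)) := by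
    rw [← Finset.sum_range_reflect]
    refine Finset.sum_congr rfl fun d hd => ?_
    have := Finset.mem_range.1 hd
    exact congrArg P (by omega)
  rw [sum_Icc_one_eq_sum_range, Finset.sum_add_distrib, ← h2, two_mul, Finset.sum_range_succ',
    Finset.sum_range_add, add_comm]

/-- The square of a sum over a period of odd length, sorted by cyclic distance. -/
theorem sum_range_sq_of_periodic {k : ℕ} {f : ℕ → A} (hf : ∀ i, f (i + (2 * k + 1)) = f i) :
    (∑ i ∈ Finset.range (2 * k + 1), f i) ^ 2 =
      ∑ i ∈ Finset.range (2 * k + 1), f i ^ 2 +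
        2 * ∑ d ∈ Finset.Icc 1 k, ∑ i ∈ Finset.range (2 * k + 1), f i * f (i + d) := by
  set m := 2 * k + 1 with hm
  let P : ℕ → A := fun d => ∑ i ∈ Finset.range m, f i * f (i + d)
  have hP : ∀ d ≤ m, P (m - d) = P d := by
    intro d hd
    have := sum_range_shift (m := m) (g := fun i => f i * f (i + (m - d)))
      (fun i => by rw [hf, show i + m + (m - d) = i + (m - d) + m by ring, hf]) d
    refine this.symm.trans (Finset.sum_congr rfl fun i _ => ?_)
    rw [show i + d + (m - d) = i + m by omega, hf, mul_comm]
  have h1 : (∑ i ∈ Finset.range m, f i) ^ 2 = ∑ d ∈ Finset.range m, P d := by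
    rw [sq, Finset.sum_mul, Finset.sum_comm]
    refine Finset.sum_congr rfl fun i _ => ?_
    rw [← Finset.mul_sum, ← sum_range_shift hf i]
    simp only [add_comm]
  rw [h1, hm, sum_range_two_mul_add_one, ← hm, Finset.mul_sum]
  congr 1
  · exact Finset.sum_congr rfl fun i _ => by rw [add_zero, sq]
  · refine Finset.sum_congr rfl fun d hd => ?_
    rw [hP d (by have := Finset.mem_Icc.1 hd; omega), two_mul]

end PeriodicSums

/-! ### Galois rings of characteristic 4: Teichmüller set, Frobenius, trace. -/

/-- Reduction modulo 2. -/
abbrev red : ZMod 4 →+* ZMod 2 := ZMod.castHom (by norm_num : 2 ∣ 4) (ZMod 2)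

/-- `R` is a Galois ring of characteristic 4 with residue field `F` of order `2 ^ m`: `ρ` is the
reduction modulo 2, `ξ` a generator of the Teichmüller set and `σ` the Frobenius automorphism. -/
structure IsGaloisRing (m : ℕ) {R F : Type*} [CommRing R] [Algebra (ZMod 4) R] [Field F]
    [Algebra (ZMod 2) F] (ρ : R →+* F) (ξ : R) (σ : R →ₐ[ZMod 4] R) : Prop where
  card : Nat.card F = 2 ^ m
  two_le : 2 ≤ m
  pow_eq_one : ξ ^ (2 ^ m - 1) = 1
  eq_zero_or_pow : ∀ x : F, x = 0 ∨ ∃ t < 2 ^ m - 1, x = ρ ξ ^ t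
  pow_injOn : Set.InjOn (fun t : ℕ => ρ ξ ^ t) {t | t < 2 ^ m - 1}
  exists_two_mul : ∀ y, ρ y = 0 → ∃ z, y = 2 * z
  map_eq_zero : ∀ y, 2 * y = 0 → ρ y = 0
  frob : σ ξ = ξ ^ 2

/-- The Teichmüller elements: `0` and the powers of `ξ`. -/
def IsTeichmuller {R : Type*} [CommRing R] (ξ u : R) : Prop := u = 0 ∨ ∃ t : ℕ, u = ξ ^ t

theorem four_eq_zero (R : Type*) [CommRing R] [Algebra (ZMod 4) R] : (4 : R) = 0 := by
  have := map_ofNat (algebraMap (ZMod 4) R) 4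
  rw [← this, show (OfNat.ofNat 4 : ZMod 4) = 0 from by decide, map_zero]

theorem two_eq_zero (F : Type*) [CommRing F] [Algebra (ZMod 2) F] : (2 : F) = 0 := by
  have := map_ofNat (algebraMap (ZMod 2) F) 2
  rw [← this, show (OfNat.ofNat 2 : ZMod 2) = 0 from by decide, map_zero]

theorem IsTeichmuller.mul {R : Type*} [CommRing R] {ξ u v : R} (hu : IsTeichmuller ξ u)
    (hv : IsTeichmuller ξ v) :
    IsTeichmuller ξ (u * v) := by
  rcases hu with rfl | ⟨s, rfl⟩
  · exact Or.inl (zero_mul _)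
  rcases hv with rfl | ⟨t, rfl⟩
  · exact Or.inl (mul_zero _)
  · exact Or.inr ⟨s + t, (pow_add _ _ _).symm⟩

theorem map_two_mul {R F : Type*} [CommRing R] [CommRing F] [Algebra (ZMod 2) F] (ρ : R →+* F)
    (z : R) : ρ (2 * z) = 0 := by
  rw [map_mul, map_ofNat, two_eq_zero, zero_mul]

theorem finrank_eq_of_card {F : Type*} [Field F] [Algebra (ZMod 2) F] {m : ℕ}
    (hF : Nat.card F = 2 ^ m) : Module.finrank (ZMod 2) F = m := by
  have : Finite F := Nat.finite_of_card_ne_zero (by rw [hF]; positivity)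
  have h := Module.natCard_eq_pow_finrank (K := ZMod 2) (V := F)
  rw [hF, Nat.card_zmod] at h
  exact (Nat.pow_right_injective le_rfl h).symm

theorem algebraMap_tr {F : Type*} [Field F] [Algebra (ZMod 2) F] {m : ℕ}
    (hF : Nat.card F = 2 ^ m) (x : F) :
    algebraMap (ZMod 2) F (tr x) = ∑ i ∈ Finset.range m, x ^ 2 ^ i := by
  have : Finite F := Nat.finite_of_card_ne_zero (by rw [hF]; positivity)
  rw [tr, FiniteField.algebraMap_trace_eq_sum_pow, finrank_eq_of_card hF, Nat.card_zmod]

namespace IsGaloisRing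

variable {m : ℕ} {R F : Type*} [CommRing R] [Algebra (ZMod 4) R] [Field F]
    [Algebra (ZMod 2) F] {ρ : R →+* F} {ξ : R} {σ : R →ₐ[ZMod 4] R}

theorem finite (H : IsGaloisRing m ρ ξ σ) : Finite F :=
  Nat.finite_of_card_ne_zero (by rw [H.card]; positivity)

theorem map_algebraMap (ρ : R →+* F) (c : ZMod 4) :
    ρ (algebraMap (ZMod 4) R c) = algebraMap (ZMod 2) F (red c) :=
  RingHom.congr_fun (Subsingleton.elim (ρ.comp (algebraMap (ZMod 4) R))
    ((algebraMap (ZMod 2) F).comp red)) c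

theorem two_mul_eq_zero_iff (H : IsGaloisRing m ρ ξ σ) (y : R) : 2 * y = 0 ↔ ρ y = 0 := by
  refine ⟨H.map_eq_zero y, fun h => ?_⟩
  obtain ⟨z, rfl⟩ := H.exists_two_mul y h
  linear_combination z * four_eq_zero R

theorem algebraMap_injective (H : IsGaloisRing m ρ ξ σ) :
    Function.Injective (algebraMap (ZMod 4) R) := by
  rw [injective_iff_map_eq_zero]
  intro c hc
  have h1 : red c = 0 := by
    have := map_algebraMap ρ c
    rw [hc, map_zero] at this
    exact (_root_.map_eq_zero (algebraMap (ZMod 2) F)).1 this.symm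
  have h2 : ∀ c : ZMod 4, red c = 0 → c = 0 ∨ c = 2 := by decide
  rcases h2 c h1 with rfl | rfl
  · rfl
  · have := H.map_eq_zero 1 (by rw [mul_one, ← hc, map_ofNat])
    rw [map_one] at this
    exact absurd this one_ne_zero

theorem exists_teichmuller (H : IsGaloisRing m ρ ξ σ) (x : F) :
    ∃ u, IsTeichmuller ξ u ∧ ρ u = x := by
  rcases H.eq_zero_or_pow x with rfl | ⟨t, -, rfl⟩
  · exact ⟨0, Or.inl rfl, map_zero _⟩
  · exact ⟨ξ ^ t, Or.inr ⟨t, rfl⟩, map_pow _ _ _⟩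

theorem map_surjective (H : IsGaloisRing m ρ ξ σ) : Function.Surjective ρ := fun x =>
  let ⟨u, _, hu⟩ := H.exists_teichmuller x
  ⟨u, hu⟩

/-- The 2-adic expansion. -/
theorem exists_expansion (H : IsGaloisRing m ρ ξ σ) (y : R) :
    ∃ a b, IsTeichmuller ξ a ∧ IsTeichmuller ξ b ∧ y = a + 2 * b := by
  obtain ⟨a, ha, hay⟩ := H.exists_teichmuller (ρ y)
  obtain ⟨z, hz⟩ := H.exists_two_mul (y - a) (by rw [map_sub, hay, sub_self])
  obtain ⟨b, hb, hbz⟩ := H.exists_teichmuller (ρ z)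
  refine ⟨a, b, ha, hb, ?_⟩
  have := (H.two_mul_eq_zero_iff (z - b)).2 (by rw [map_sub, hbz, sub_self])
  linear_combination hz + this

theorem isUnit_of_map_ne_zero (H : IsGaloisRing m ρ ξ σ) {y : R} (hy : ρ y ≠ 0) : IsUnit y := by
  obtain ⟨z, hz⟩ := H.map_surjective (ρ y)⁻¹
  obtain ⟨w, hw⟩ := H.exists_two_mul (y * z - 1) (by
    rw [map_sub, map_mul, hz, mul_inv_cancel₀ hy, map_one, sub_self])
  -- Here `y * z = 1 + 2 * w`, and `(1 + 2 * w) * (1 - 2 * w) = 1` since `4 = 0`.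
  refine IsUnit.of_mul_eq_one (z * (1 - 2 * w)) ?_
  linear_combination (1 - 2 * w) * hw - w ^ 2 * four_eq_zero R

theorem frob_teichmuller (H : IsGaloisRing m ρ ξ σ) {u : R} (hu : IsTeichmuller ξ u) :
    σ u = u ^ 2 := by
  rcases hu with rfl | ⟨t, rfl⟩
  · simp
  · rw [map_pow, H.frob, ← pow_mul, ← pow_mul, mul_comm]

theorem frob_pow_teichmuller (H : IsGaloisRing m ρ ξ σ) {u : R} (hu : IsTeichmuller ξ u) (i : ℕ) :
    (σ ^ i) u = u ^ 2 ^ i := by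
  induction i with
  | zero => simp
  | succ i ih =>
    rw [pow_succ, AlgHom.mul_apply, H.frob_teichmuller hu, map_pow, ih, ← pow_mul, pow_succ]

theorem teichmuller_pow_two_pow (H : IsGaloisRing m ρ ξ σ) {u : R} (hu : IsTeichmuller ξ u) :
    u ^ 2 ^ m = u := by
  rcases hu with rfl | ⟨t, rfl⟩
  · simp
  · have : 2 ^ m = 2 ^ m - 1 + 1 := by have := Nat.one_le_two_pow (n := m); omega
    rw [this, pow_succ, pow_right_comm, H.pow_eq_one, one_pow, one_mul]

theorem frob_pow_eq_one (H : IsGaloisRing m ρ ξ σ) : σ ^ m = 1 := by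
  ext y
  obtain ⟨a, b, ha, hb, rfl⟩ := H.exists_expansion y
  rw [map_add, map_mul, map_ofNat, H.frob_pow_teichmuller ha, H.frob_pow_teichmuller hb,
    H.teichmuller_pow_two_pow ha, H.teichmuller_pow_two_pow hb, AlgHom.one_apply]

theorem map_frob (H : IsGaloisRing m ρ ξ σ) (y : R) : ρ (σ y) = ρ y ^ 2 := by
  obtain ⟨a, b, ha, -, rfl⟩ := H.exists_expansion y
  rw [map_add, map_mul, map_ofNat, map_add, map_add, map_two_mul, map_two_mul,
    H.frob_teichmuller ha, map_pow, add_zero, add_zero]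

theorem map_frob_pow (H : IsGaloisRing m ρ ξ σ) (i : ℕ) (y : R) :
    ρ ((σ ^ i) y) = ρ y ^ 2 ^ i := by
  induction i with
  | zero => simp
  | succ i ih => rw [pow_succ', AlgHom.mul_apply, H.map_frob, ih, ← pow_mul, pow_succ]

theorem map_eq_zero_or_one_of_frob_eq (H : IsGaloisRing m ρ ξ σ) {y : R}
    (hy : ρ (σ y) = ρ y) : ∃ c : ZMod 4, ρ y = ρ (algebraMap (ZMod 4) R c) := by
  rw [H.map_frob] at hy
  have : ρ y * (ρ y - 1) = 0 := by linear_combination hy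
  rcases mul_eq_zero.1 this with h | h
  · exact ⟨0, by rw [h, map_zero, map_zero]⟩
  · exact ⟨1, by rw [sub_eq_zero.1 h, map_one, map_one]⟩

/-- One 2-adic digit at a time: modulo 2 a fixed element is 0 or 1; after subtracting a lift `c` the
remainder is `2 * z` with `z` fixed modulo 2, which supplies the second digit `d`. -/
theorem mem_range_of_frob_eq (H : IsGaloisRing m ρ ξ σ) {y : R} (hy : σ y = y) :
    ∃ c : ZMod 4, algebraMap (ZMod 4) R c = y := by
  obtain ⟨c, hc⟩ := H.map_eq_zero_or_one_of_frob_eq (congrArg ρ hy)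
  obtain ⟨z, hz⟩ := H.exists_two_mul (y - algebraMap _ _ c) (by rw [map_sub, hc, sub_self])
  have hσ : 2 * (σ z - z) = 0 := by
    have h1 : σ (y - algebraMap _ _ c) = y - algebraMap _ _ c := by
      rw [map_sub, hy, AlgHom.commutes]
    rw [hz, map_mul, map_ofNat] at h1
    linear_combination h1
  rw [H.two_mul_eq_zero_iff, map_sub, sub_eq_zero] at hσ
  obtain ⟨d, hd⟩ := H.map_eq_zero_or_one_of_frob_eq hσ
  have h2 := (H.two_mul_eq_zero_iff (z - algebraMap _ _ d)).2 (by rw [map_sub, hd, sub_self])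
  refine ⟨c + 2 * d, ?_⟩
  rw [map_add, map_mul, map_ofNat]
  linear_combination -hz - h2

/-- The trace of a Galois ring. -/
theorem exists_trace (H : IsGaloisRing m ρ ξ σ) : ∃ T : R →ₗ[ZMod 4] ZMod 4,
    ∀ y, algebraMap (ZMod 4) R (T y) = ∑ i ∈ Finset.range m, (σ ^ i) y := by
  have h : ∀ y, ∃ c, algebraMap (ZMod 4) R c = ∑ i ∈ Finset.range m, (σ ^ i) y := by
    intro y
    apply H.mem_range_of_frob_eq
    rw [map_sum]
    have hp : ∀ i, (σ ^ (i + m)) y = (σ ^ i) y := fun i => by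
      rw [pow_add, H.frob_pow_eq_one, mul_one]
    rw [← sum_range_shift (g := fun i => (σ ^ i) y) hp 1]
    refine Finset.sum_congr rfl fun i _ => ?_
    rw [pow_succ', AlgHom.mul_apply]
  choose T hT using h
  refine ⟨⟨⟨T, fun x y => ?_⟩, fun c x => ?_⟩, hT⟩
  · apply H.algebraMap_injective
    simp only [hT, map_add, Finset.sum_add_distrib]
  · apply H.algebraMap_injective
    simp only [hT, smul_eq_mul, map_mul, RingHom.id_apply, Algebra.smul_def,
      Finset.mul_sum, AlgHom.commutes]

/-- A trace functional: the sum of the conjugates. -/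
def IsTrace (m : ℕ) (σ : R →ₐ[ZMod 4] R) (T : R →ₗ[ZMod 4] ZMod 4) : Prop :=
  ∀ y, algebraMap (ZMod 4) R (T y) = ∑ i ∈ Finset.range m, (σ ^ i) y

variable {T : R →ₗ[ZMod 4] ZMod 4}

theorem red_trace (H : IsGaloisRing m ρ ξ σ) (hT : IsTrace m σ T) (y : R) :
    red (T y) = tr (ρ y) := by
  apply (algebraMap (ZMod 2) F).injective
  rw [← map_algebraMap ρ, hT, algebraMap_tr H.card, map_sum]
  exact Finset.sum_congr rfl fun i _ => H.map_frob_pow i y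

theorem exists_tr_ne_zero [Finite F] {a : F} (ha : a ≠ 0) : ∃ b, tr (a * b) ≠ 0 := by
  have h := (traceForm_nondegenerate (ZMod 2) F).1 a
  simp_rw [Algebra.traceForm_apply] at h
  by_contra! hf
  exact ha (h hf)

theorem map_eq_zero_of_red_trace (H : IsGaloisRing m ρ ξ σ) (hT : IsTrace m σ T) {l : R}
    (hl : ∀ t < 2 ^ m - 1, red (T (l * ξ ^ t)) = 0) : ρ l = 0 := by
  have := H.finite
  by_contra hne
  obtain ⟨b, hb⟩ := exists_tr_ne_zero hne
  rcases H.eq_zero_or_pow b with rfl | ⟨t, ht, rfl⟩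
  · exact hb (by rw [mul_zero]; exact map_zero (Algebra.trace (ZMod 2) F))
  · apply hb
    rw [← hl t ht, H.red_trace hT, map_mul, map_pow]

/-- The nondegenerate trace form of `F` is used twice: first `l = 2 * z`, then `z` itself vanishes
modulo 2. -/
theorem trace_nondegenerate (H : IsGaloisRing m ρ ξ σ) (hT : IsTrace m σ T) {l : R}
    (hl : ∀ t < 2 ^ m - 1, T (l * ξ ^ t) = 0) : l = 0 := by
  obtain ⟨z, rfl⟩ := H.exists_two_mul l (H.map_eq_zero_of_red_trace hT fun t ht => by
    rw [hl t ht, map_zero])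
  rw [H.two_mul_eq_zero_iff]
  refine H.map_eq_zero_of_red_trace hT fun t ht => ?_
  have h := hl t ht
  rw [show 2 * z * ξ ^ t = (2 : ZMod 4) • (z * ξ ^ t) by
    rw [Algebra.smul_def, map_ofNat, mul_assoc], map_smul, smul_eq_mul] at h
  revert h
  generalize T (z * ξ ^ t) = c
  revert c
  decide

/-- The conjugates `u ^ 2 ^ i` have period `m`. In the square of their sum, the squares are the same
conjugates shifted by one, and the products at cyclic distance `d` add up to `T(u ^ (1 + 2 ^ d))`.
-/
theorem trace_sq (H : IsGaloisRing m ρ ξ σ) (hT : IsTrace m σ T) (hm : Odd m) {u : R}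
    (hu : IsTeichmuller ξ u) :
    T u ^ 2 = T u + 2 * ∑ d ∈ Finset.Icc 1 ((m - 1) / 2), T (u ^ (1 + 2 ^ d)) := by
  obtain ⟨k, rfl⟩ := hm
  have hf : ∀ i, u ^ 2 ^ (i + (2 * k + 1)) = u ^ 2 ^ i := fun i => by
    rw [pow_add, mul_comm, pow_mul, H.teichmuller_pow_two_pow hu]
  have h := sum_range_sq_of_periodic (f := fun i => u ^ 2 ^ i) hf
  apply H.algebraMap_injective
  simp only [map_pow, map_add, map_mul, map_sum, map_ofNat, hT u, hT (u ^ _), 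
    H.frob_pow_teichmuller hu]
  rw [h]
  congr 1
  · rw [← sum_range_shift (g := fun i => u ^ 2 ^ i) hf 1]
    exact Finset.sum_congr rfl fun i _ => by rw [pow_succ 2, pow_mul]
  · congr 1
    refine Finset.sum_congr (by congr 1; omega) fun d _ => Finset.sum_congr rfl fun i _ => ?_
    rw [← pow_add, ← pow_mul]
    congr 1
    ring

theorem β_trace (H : IsGaloisRing m ρ ξ σ) (hT : IsTrace m σ T) (hm : Odd m) {u : R}
    (hu : IsTeichmuller ξ u) : β (T u) = Q m (ρ u) := by
  have h := H.trace_sq hT hm hu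
  -- In `ℤ/4`, `c ^ 2 - c` takes the values 0, 0, 2, 2, that is, twice the upper digit of `c`.
  have key : ∀ c e : ZMod 4, c ^ 2 = c + 2 * e → β c = red e := by decide
  rw [key _ _ h, map_sum, Q]
  refine Finset.sum_congr rfl fun d _ => ?_
  rw [H.red_trace hT, map_pow]

end IsGaloisRing

/-! ### The Galois ring `(ℤ/4)[X]/(h)` of a Hensel lift. -/

section Construction

variable {m : ℕ} {h₂ : (ZMod 2)[X]} {h : (ZMod 4)[X]}

theorem exists_root_of_dvd {F : Type*} [Field F] [Algebra (ZMod 2) F] [Finite F]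
    (hF : Nat.card F = 2 ^ m) {f : (ZMod 2)[X]} (hf : 0 < f.natDegree)
    (hdvd : f ∣ X ^ (2 ^ m - 1) - 1) : ∃ θ : F, aeval θ f = 0 := by
  have hs : (X ^ Nat.card F - X : F[X]).Splits := by
    simpa using FiniteField.splits_X_pow_nat_card_sub_X (K := F) 2
  have hd : f.map (algebraMap (ZMod 2) F) ∣ X ^ Nat.card F - X := by
    have h1 := Polynomial.map_dvd (algebraMap (ZMod 2) F) hdvd
    have h2 : (X ^ Nat.card F - X : F[X]) = (X ^ (2 ^ m - 1) - 1) * X := by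
      have : 2 ^ m = 2 ^ m - 1 + 1 := by have := Nat.one_le_two_pow (n := m); omega
      rw [hF, sub_mul, ← pow_succ, ← this, one_mul]
    rw [h2]
    refine Dvd.dvd.mul_right ?_ _
    simpa using h1
  have hne : (X ^ Nat.card F - X : F[X]) ≠ 0 :=
    FiniteField.X_pow_card_sub_X_ne_zero F Finite.one_lt_card
  have hsp := hs.of_dvd hne hd
  obtain ⟨θ, hθ⟩ := hsp.exists_eval_eq_zero (by
    rw [degree_map]
    exact (natDegree_pos_iff_degree_pos.1 hf).ne')
  exact ⟨θ, by rwa [eval_map_algebraMap] at hθ⟩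

theorem orderOf_root {F : Type*} [Field F] [Algebra (ZMod 2) F] (hprim : IsPrimitiveBinary h₂)
    {θ : F} (hθ : aeval θ h₂ = 0) : orderOf θ = 2 ^ h₂.natDegree - 1 := by
  have : Fact (Irreducible h₂) := ⟨hprim.1⟩
  rw [← hprim.2, ← AdjoinRoot.lift_root (i := algebraMap (ZMod 2) F) (a := θ) hθ]
  exact orderOf_injective _ (RingHom.injective _) _

theorem exists_eq_two_mul_of_map_eq_zero {p : (ZMod 4)[X]} (hp : p.map red = 0) :
    ∃ r, p = 2 * r := by
  have : (C 2 : (ZMod 4)[X]) ∣ p := by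
    rw [C_dvd_iff_dvd_coeff]
    intro i
    have h0 : red (p.coeff i) = 0 := by rw [← coeff_map, hp, coeff_zero]
    have key : ∀ c : ZMod 4, red c = 0 → ∃ d, c = 2 * d := by decide
    exact key _ h0
  obtain ⟨r, hr⟩ := this
  exact ⟨r, by rw [hr, map_ofNat]⟩

theorem map_eq_zero_of_two_mul_eq_zero {p : (ZMod 4)[X]} (hp : 2 * p = 0) : p.map red = 0 := by
  ext i
  have h0 : 2 * p.coeff i = 0 := by
    have := congrArg (fun q => q.coeff i) hp
    simpa [← map_ofNat (C : ZMod 4 →+* (ZMod 4)[X]), coeff_C_mul] using this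
  have key : ∀ c : ZMod 4, 2 * c = 0 → red c = 0 := by decide
  rw [coeff_map, key _ h0, coeff_zero]

theorem map_two (p : (ZMod 4)[X]) : (2 * p).map red = 0 := by
  rw [Polynomial.map_mul, Polynomial.map_ofNat, two_eq_zero, zero_mul]

theorem dvd_of_aeval_eq_zero {F : Type*} [Field F] [Algebra (ZMod 2) F] (hirr : Irreducible h₂)
    (hmon : h₂.Monic) {θ : F} (hθ : aeval θ h₂ = 0) {p : (ZMod 2)[X]} (hp : aeval θ p = 0) :
    h₂ ∣ p := by
  rw [minpoly.eq_of_irreducible_of_monic hirr hθ hmon]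
  exact minpoly.dvd _ _ hp

/-- The residue map of the Galois ring `(ℤ/4)[X] / (h)`. -/
noncomputable def residue {F : Type*} [Field F] [Algebra (ZMod 2) F]
    (hh : h.map red = h₂) {θ : F} (hθ : aeval θ h₂ = 0) : AdjoinRoot h →+* F :=
  AdjoinRoot.lift ((algebraMap (ZMod 2) F).comp red) θ (by
    rw [← eval₂_map, hh]; exact hθ)

theorem residue_mk {F : Type*} [Field F] [Algebra (ZMod 2) F]
    (hh : h.map red = h₂) {θ : F} (hθ : aeval θ h₂ = 0) (p : (ZMod 4)[X]) :
    residue hh hθ (AdjoinRoot.mk h p) = aeval θ (p.map red) := by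
  rw [residue, AdjoinRoot.lift_mk, ← eval₂_map, aeval_def]

theorem residue_root {F : Type*} [Field F] [Algebra (ZMod 2) F]
    (hh : h.map red = h₂) {θ : F} (hθ : aeval θ h₂ = 0) :
    residue hh hθ (AdjoinRoot.root h) = θ := by
  rw [residue, AdjoinRoot.lift_root]

section

variable {F : Type*} [Field F] [Algebra (ZMod 2) F] (hh : h.map red = h₂) {θ : F}
  (hθ : aeval θ h₂ = 0)

theorem exists_two_mul_of_residue (hirr : Irreducible h₂) (hmon : h₂.Monic) (y : AdjoinRoot h)
    (hy : residue hh hθ y = 0) : ∃ z, y = 2 * z := by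
  obtain ⟨p, rfl⟩ := AdjoinRoot.mk_surjective y
  rw [residue_mk] at hy
  obtain ⟨q, hq⟩ := dvd_of_aeval_eq_zero hirr hmon hθ hy
  obtain ⟨q', rfl⟩ := Polynomial.map_surjective red (ZMod.ringHom_surjective red) q
  obtain ⟨r, hr⟩ := exists_eq_two_mul_of_map_eq_zero (p := p - h * q') (by
    rw [Polynomial.map_sub, Polynomial.map_mul, hh, hq, sub_self])
  refine ⟨AdjoinRoot.mk h r, ?_⟩
  rw [sub_eq_iff_eq_add.1 hr, map_add, map_mul, map_mul, AdjoinRoot.mk_self, zero_mul, add_zero,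
    map_ofNat]

theorem residue_eq_zero_of_two_mul (hirr : Irreducible h₂) (y : AdjoinRoot h)
    (hy : 2 * y = 0) : residue hh hθ y = 0 := by
  obtain ⟨p, rfl⟩ := AdjoinRoot.mk_surjective y
  rw [← map_ofNat (AdjoinRoot.mk h) 2, ← map_mul, AdjoinRoot.mk_eq_zero] at hy
  obtain ⟨q, hq⟩ := hy
  -- Reducing `2 * p = h * q` modulo 2 kills the left side, so `q` is even and the equation can be
  -- halved.
  have h1 : q.map red = 0 := by
    have := congrArg (Polynomial.map red) hq
    rw [map_two, Polynomial.map_mul, hh] at this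
    exact (mul_eq_zero.1 this.symm).resolve_left hirr.ne_zero
  obtain ⟨r, rfl⟩ := exists_eq_two_mul_of_map_eq_zero h1
  have h2 := map_eq_zero_of_two_mul_eq_zero (p := p - h * r) (by linear_combination hq)
  rw [Polynomial.map_sub, sub_eq_zero, Polynomial.map_mul, hh] at h2
  rw [residue_mk, h2, map_mul, hθ, zero_mul]

end

/-- This makes the Frobenius `ξ ↦ ξ ^ 2` well defined. With `h * k = X ^ n - 1`, the product of
`h(ξ²)` and `k(ξ²)` is 0. The residue of `h(ξ²)` is `h₂(θ)² = 0`, that of `k(ξ²)` is nonzero, so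
`h(ξ²)` is even and then divisible by 4. -/
theorem aeval_root_sq {n : ℕ} (hn : Odd n) {h₂ : (ZMod 2)[X]} (hirr : Irreducible h₂)
    (hmon : h₂.Monic) (hh : h.map red = h₂) (hdvd : h ∣ X ^ n - 1) :
    aeval (AdjoinRoot.root h ^ 2) h = 0 := by
  have : Fact (Irreducible h₂) := ⟨hirr⟩
  set ξ := AdjoinRoot.root h
  have hθ : aeval (AdjoinRoot.root h₂) h₂ = 0 := AdjoinRoot.eval₂_root h₂
  set θ := AdjoinRoot.root h₂
  obtain ⟨k, hk⟩ := hdvd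
  have hξ : ξ ^ n = 1 := by
    have := congrArg (AdjoinRoot.mk h) hk
    rw [map_mul, AdjoinRoot.mk_self, zero_mul] at this
    simpa [sub_eq_zero] using this
  have hθn : θ ^ n = 1 := by
    rw [← residue_root hh hθ, ← map_pow, hξ, map_one]
  have hk2 : h₂ * k.map red = X ^ n - 1 := by
    rw [← hh, ← Polynomial.map_mul, ← hk]; simp
  -- Otherwise `θ` would be a double root of `X ^ n - 1`, whose derivative at `θ` is `θ ^ (n - 1)`
  -- for odd `n`.
  have hkθ : aeval θ (k.map red) ≠ 0 := by
    intro h0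
    have h1 := congrArg (fun p => aeval θ (derivative p)) hk2
    simp only [derivative_mul, map_add, map_mul, hθ, h0, derivative_one,
      derivative_X_pow, map_sub, aeval_X_pow, sub_zero, mul_zero, zero_mul, add_zero] at h1
    have h2 : (n : ZMod 2) = 1 := (ZMod.natCast_eq_one_iff_odd).2 hn
    rw [h2, map_one, map_one, one_mul] at h1
    have h3 : θ ^ n = 0 := by
      have hn0 : n ≠ 0 := hn.pos.ne'
      rw [← Nat.succ_pred_eq_of_ne_zero hn0, pow_succ, Nat.pred_eq_sub_one, ← h1, zero_mul]
    rw [hθn] at h3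
    exact one_ne_zero h3
  have hres : ∀ p : (ZMod 4)[X], residue hh hθ (aeval (ξ ^ 2) p) = aeval θ (p.map red) ^ 2 := by
    intro p
    rw [← expand_aeval, AdjoinRoot.aeval_eq, residue_mk, map_expand, ZMod.expand_card, map_pow]
  have hprod : aeval (ξ ^ 2) k * aeval (ξ ^ 2) h = 0 := by
    rw [mul_comm, ← map_mul, ← hk, map_sub, map_pow, aeval_X, map_one, pow_right_comm, hξ, one_pow,
      sub_self]
  have hkne : residue hh hθ (aeval (ξ ^ 2) k) ≠ 0 := by
    rw [hres]; exact pow_ne_zero _ hkθ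
  have hhe : residue hh hθ (aeval (ξ ^ 2) h) = 0 := by
    rw [hres, hh, hθ]; simp
  obtain ⟨z, hz⟩ := exists_two_mul_of_residue hh hθ hirr hmon _ hhe
  have h2 : 2 * (aeval (ξ ^ 2) k * z) = 0 := by rw [← hprod, hz]; ring
  have h3 := residue_eq_zero_of_two_mul hh hθ hirr _ h2
  rw [map_mul] at h3
  obtain ⟨w, rfl⟩ := exists_two_mul_of_residue hh hθ hirr hmon z
    ((mul_eq_zero.1 h3).resolve_left hkne)
  rw [hz]
  linear_combination w * four_eq_zero (AdjoinRoot h)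

theorem monic_of_isHenselLift (hlift : IsHenselLift m h₂ h) : h₂.Monic := by
  rw [← hlift.2.2.1]
  exact hlift.1.map _

theorem root_pow_eq_one (hlift : IsHenselLift m h₂ h) :
    AdjoinRoot.root h ^ (2 ^ m - 1) = 1 := by
  obtain ⟨k, hk⟩ := hlift.2.2.2
  have := congrArg (AdjoinRoot.mk h) hk
  rw [map_mul, AdjoinRoot.mk_self, zero_mul] at this
  simpa [sub_eq_zero] using this

theorem isPrimitiveRoot {F : Type*} [Field F] [Algebra (ZMod 2) F] (hprim : IsPrimitiveBinary h₂)
    (hdeg : h₂.natDegree = m) {θ : F} (hθ : aeval θ h₂ = 0) : IsPrimitiveRoot θ (2 ^ m - 1) := by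
  have := IsPrimitiveRoot.orderOf θ
  rwa [orderOf_root hprim hθ, hdeg] at this

theorem odd_two_pow_sub_one (hm : m ≠ 0) : Odd (2 ^ m - 1) := by
  obtain ⟨k, rfl⟩ := Nat.exists_eq_succ_of_ne_zero hm
  have := Nat.one_le_two_pow (n := k)
  exact ⟨2 ^ k - 1, by rw [Nat.succ_eq_add_one, pow_succ]; omega⟩

theorem exists_isGaloisRing {F : Type*} [Field F] [Algebra (ZMod 2) F]
    (hF : Nat.card F = 2 ^ m) (hm : 2 ≤ m) (hprim : IsPrimitiveBinary h₂)
    (hdeg : h₂.natDegree = m) (hlift : IsHenselLift m h₂ h) {θ : F} (hθ : aeval θ h₂ = 0) :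
    ∃ σ, IsGaloisRing m (residue hlift.2.2.1 hθ) (AdjoinRoot.root h) σ := by
  have hmon := monic_of_isHenselLift hlift
  have hn := odd_two_pow_sub_one (m := m) (by omega)
  have hprimθ := isPrimitiveRoot hprim hdeg hθ
  have : Finite F := Nat.finite_of_card_ne_zero (by rw [hF]; positivity)
  refine ⟨AdjoinRoot.liftAlgHom h (Algebra.ofId _ _) (AdjoinRoot.root h ^ 2)
    (aeval_root_sq hn hprim.1 hmon hlift.2.2.1 hlift.2.2.2), hF, hm, root_pow_eq_one hlift, ?_, ?_,
    exists_two_mul_of_residue _ _ hprim.1 hmon, residue_eq_zero_of_two_mul _ _ hprim.1, ?_⟩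
  · intro x
    rw [residue_root, or_iff_not_imp_left]
    intro hx
    have hpos : NeZero (2 ^ m - 1) := ⟨hn.pos.ne'⟩
    obtain ⟨t, ht, hxt⟩ := hprimθ.eq_pow_of_pow_eq_one (ξ := x) (by
      have := Fintype.ofFinite F
      rw [← hF, Nat.card_eq_fintype_card]
      exact FiniteField.pow_card_sub_one_eq_one x hx)
    exact ⟨t, ht, hxt.symm⟩
  · rw [residue_root]
    intro s hs t ht hst
    exact hprimθ.pow_inj hs ht hst
  · exact AdjoinRoot.liftAlgHom_root h _ _ _

/-- The factor `X - 1` is coprime to `h`. -/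
theorem X_sub_one_mul_dvd (hm : 2 ≤ m) (hprim : IsPrimitiveBinary h₂)
    (hdeg : h₂.natDegree = m) (hlift : IsHenselLift m h₂ h) :
    (X - 1) * h ∣ X ^ (2 ^ m - 1) - 1 := by
  obtain ⟨k, hk⟩ := hlift.2.2.2
  -- An irreducible `h₂` of degree at least 2 has no root, so `h(1)` is a unit and the cofactor `k`
  -- vanishes at 1.
  have h1 : red (h.eval 1) ≠ 0 := by
    rw [← eval₂_hom, ← eval_map, map_one, hlift.2.2.1]
    exact hprim.1.not_isRoot_of_natDegree_ne_one (by omega)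
  have h2 : h.eval 1 * k.eval 1 = 0 := by
    rw [← eval_mul, ← hk]; simp
  have key : ∀ a b : ZMod 4, red a ≠ 0 → a * b = 0 → b = 0 := by decide
  obtain ⟨q, hq⟩ := dvd_iff_isRoot.2 (key _ _ h1 h2)
  exact ⟨q, by rw [hk, hq, C_1]; ring⟩

end Construction

/-! ### Trace words and their Gray images. -/

section Trace

variable {F : Type*} [Field F] [Algebra (ZMod 2) F]

theorem tr_add (x y : F) : tr (x + y) = tr x + tr y := map_add (Algebra.trace (ZMod 2) F) x y

theorem tr_zero : tr (0 : F) = 0 := map_zero (Algebra.trace (ZMod 2) F)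

theorem tr_algebraMap_mul (c : ZMod 2) (x : F) : tr (algebraMap (ZMod 2) F c * x) = c * tr x := by
  rw [← Algebra.smul_def]
  exact map_smul (Algebra.trace (ZMod 2) F) c x

end Trace

/-- `red` and `β` are the lower and upper binary digits; `red e * red x` is the carry. -/
theorem β_add_two_mul_add (x y e : ZMod 4) :
    β (x + 2 * y + e) = β x + red y + β e + red e * red x := by
  revert x y e; decide

theorem γ_eq (x : ZMod 4) : γ x = β x + red x := by revert x; decide

theorem exists_red_β (A B : ZMod 2) : ∃ e : ZMod 4, red e = A ∧ β e = B := by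
  revert A B; decide

/-- The Teichmüller element at a coordinate of the extended cyclic code. -/
def teichPoint {R : Type*} [CommRing R] (ξ : R) {n : ℕ} : Option (Fin n) → R
  | some t => ξ ^ (t : ℕ)
  | none => 0

/-- The word `x ↦ T(l x) + e` on the Teichmüller set. -/
def traceWord {R : Type*} [CommRing R] [Algebra (ZMod 4) R] (n : ℕ) (ξ : R)
    (T : R →ₗ[ZMod 4] ZMod 4) (l : R) (e : ZMod 4) : Option (Fin n) → ZMod 4 :=
  fun p => T (l * teichPoint ξ p) + e

theorem isTeichmuller_teichPoint {R : Type*} [CommRing R] (ξ : R) {n : ℕ} (p : Option (Fin n)) :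
    IsTeichmuller ξ (teichPoint ξ p) := by
  cases p with
  | none => exact Or.inl rfl
  | some t => exact Or.inr ⟨t, rfl⟩

theorem map_teichPoint {R F : Type*} [CommRing R] [Field F] (ρ : R →+* F) (ξ : R) {n : ℕ}
    (p : Option (Fin n)) : ρ (teichPoint ξ p) = point (ρ ξ) p := by
  cases p with
  | none => exact map_zero ρ
  | some t => exact map_pow ρ ξ _

namespace IsGaloisRing

variable {m : ℕ} {R F : Type*} [CommRing R] [Algebra (ZMod 4) R] [Field F]
    [Algebra (ZMod 2) F] {ρ : R →+* F} {ξ : R} {σ : R →ₐ[ZMod 4] R} {T : R →ₗ[ZMod 4] ZMod 4}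

theorem three_le (H : IsGaloisRing m ρ ξ σ) : 3 ≤ 2 ^ m - 1 := by
  have := Nat.pow_le_pow_right (n := 2) (by norm_num) H.two_le
  omega

theorem geom_sum_eq_zero (H : IsGaloisRing m ρ ξ σ) :
    ∑ t ∈ Finset.range (2 ^ m - 1), ξ ^ t = 0 := by
  have h3 := H.three_le
  have hne : ρ (ξ - 1) ≠ 0 := by
    intro h
    rw [map_sub, map_one, sub_eq_zero] at h
    have := H.pow_injOn (show 0 ∈ {t | t < 2 ^ m - 1} from (by omega : 0 < 2 ^ m - 1))
      (show 1 ∈ {t | t < 2 ^ m - 1} from (by omega : 1 < 2 ^ m - 1)) (by simp [h])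
    exact absurd this (by norm_num)
  rw [← (H.isUnit_of_map_ne_zero hne).mul_right_eq_zero, mul_geom_sum, H.pow_eq_one, sub_self]

/-- The powers of `ξ` sum to 0, so the value `e` at the Teichmüller point 0 is the right parity
check: `e` is counted `2 ^ m` times, a multiple of 4. -/
theorem sum_traceWord (H : IsGaloisRing m ρ ξ σ) (l : R) (e : ZMod 4) :
    ∑ p, traceWord (2 ^ m - 1) ξ T l e p = 0 := by
  have h1 : ∑ p : Option (Fin (2 ^ m - 1)), T (l * teichPoint ξ p) = 0 := by
    rw [← map_sum, ← Finset.mul_sum, Fintype.sum_option]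
    simp only [teichPoint]
    rw [Fin.sum_univ_eq_sum_range (fun t => ξ ^ t), H.geom_sum_eq_zero]
    simp
  have h2 : ((2 ^ m : ℕ) : ZMod 4) = 0 := by
    rw [ZMod.natCast_eq_zero_iff]
    exact pow_dvd_pow 2 H.two_le
  simp only [traceWord]
  rw [Finset.sum_add_distrib, h1, Finset.sum_const, zero_add, Finset.card_univ, Fintype.card_option,
    Fintype.card_fin, Nat.sub_add_cancel Nat.one_le_two_pow, nsmul_eq_mul, h2, zero_mul]

theorem traceWord_injective (H : IsGaloisRing m ρ ξ σ) (hT : IsTrace m σ T) :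
    Function.Injective fun le : R × ZMod 4 => traceWord (2 ^ m - 1) ξ T le.1 le.2 := by
  rintro ⟨l, e⟩ ⟨l', e'⟩ h
  have he : e = e' := by simpa [traceWord, teichPoint] using congrFun h none
  subst he
  have hl : l - l' = 0 := by
    refine H.trace_nondegenerate hT fun t ht => ?_
    have h1 : T (l * ξ ^ t) = T (l' * ξ ^ t) := by
      simpa [traceWord, teichPoint] using congrFun h (some ⟨t, ht⟩)
    rw [sub_mul, map_sub, h1, sub_self]
  rw [sub_eq_zero.1 hl]

theorem point_bijective (H : IsGaloisRing m ρ ξ σ) :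
    Function.Bijective (point (ρ ξ) (n := 2 ^ m - 1)) := by
  have hne : ρ ξ ≠ 0 := by
    intro h0
    have := congrArg ρ H.pow_eq_one
    rw [map_pow, h0, map_one, zero_pow (by have := H.three_le; omega)] at this
    exact zero_ne_one this
  constructor
  · rintro (_ | s) (_ | t) hst
    · rfl
    · exact absurd hst.symm (pow_ne_zero _ hne)
    · exact absurd hst (pow_ne_zero _ hne)
    · exact congrArg some (Fin.ext (H.pow_injOn s.2 t.2 hst))
  · intro x
    rcases H.eq_zero_or_pow x with rfl | ⟨t, ht, rfl⟩
    · exact ⟨none, rfl⟩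
    · exact ⟨some ⟨t, ht⟩, rfl⟩

theorem binaryPoint_bijective (H : IsGaloisRing m ρ ξ σ) :
    Function.Bijective (binaryPoint (ρ ξ) (n := 2 ^ m - 1)) := by
  constructor
  · rintro (p | p) (q | q) hpq
    · exact congrArg Sum.inl (H.point_bijective.1 (congrArg Prod.fst hpq))
    · exact absurd (congrArg Prod.snd hpq) zero_ne_one
    · exact absurd (congrArg Prod.snd hpq) one_ne_zero
    · exact congrArg Sum.inr (H.point_bijective.1 (congrArg Prod.fst hpq))
  · rintro ⟨x, e⟩
    obtain ⟨p, rfl⟩ := H.point_bijective.2 x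
    have key : ∀ e : ZMod 2, e = 0 ∨ e = 1 := by decide
    rcases key e with rfl | rfl
    · exact ⟨Sum.inl p, rfl⟩
    · exact ⟨Sum.inr p, rfl⟩

end IsGaloisRing

/-- The Boolean function `q_π + tr(η x) + A e + B`. -/
noncomputable def kerdockWord {F : Type*} [Field F] [Algebra (ZMod 2) F] (m : ℕ) (π η : F)
    (A B : ZMod 2) : F × ZMod 2 → ZMod 2 :=
  fun z => Q m (π * z.1) + z.2 * tr (π * z.1) + (tr (η * z.1) + A * z.2 + B)

theorem mem_kerdockCode_iff {F : Type*} [Field F] [Algebra (ZMod 2) F] {m : ℕ}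
    {w : F × ZMod 2 → ZMod 2} :
    w ∈ kerdockCode F m ↔ ∃ π η A B, w = kerdockWord m π η A B := by
  constructor
  · rintro ⟨π, r, ⟨η, A, B, hr⟩, hw⟩
    refine ⟨π, η, A, B, funext fun ⟨x, e⟩ => ?_⟩
    rw [hw, hr]
    rfl
  · rintro ⟨π, η, A, B, rfl⟩
    exact ⟨π, fun z => tr (η * z.1) + A * z.2 + B, ⟨η, A, B, fun _ _ => rfl⟩, fun _ _ => rfl⟩

namespace IsGaloisRing

variable {m : ℕ} {R F : Type*} [CommRing R] [Algebra (ZMod 4) R] [Field F]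
    [Algebra (ZMod 2) F] {ρ : R →+* F} {ξ : R} {σ : R →ₐ[ZMod 4] R} {T : R →ₗ[ZMod 4] ZMod 4}

/-- The digit of `T(a x)` gives `Q`, the summand `2 T(b x)` gives `tr(ρ b x)`, and the carry with
`e` adds `red e * tr(ρ a x)`, which is the correction in `η`. The right half adds the lower digit,
by `γ_eq`. -/
theorem gray_traceWord (H : IsGaloisRing m ρ ξ σ) (hT : IsTrace m σ T) (hm : Odd m) {a : R}
    (ha : IsTeichmuller ξ a) (b : R) (e : ZMod 4) :
    gray (traceWord (2 ^ m - 1) ξ T (a + 2 * b) e) =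
      kerdockWord m (ρ a) (ρ b + algebraMap (ZMod 2) F (red e) * ρ a) (red e) (β e) ∘
        binaryPoint (ρ ξ) := by
  have hlin : ∀ p : Option (Fin (2 ^ m - 1)), traceWord (2 ^ m - 1) ξ T (a + 2 * b) e p =
      T (a * teichPoint ξ p) + 2 * T (b * teichPoint ξ p) + e := by
    intro p
    rw [traceWord, add_mul, map_add, show 2 * b * teichPoint ξ p =
      (2 : ZMod 4) • (b * teichPoint ξ p) by rw [Algebra.smul_def, map_ofNat, mul_assoc], map_smul,
      smul_eq_mul]
  have hβ : ∀ p : Option (Fin (2 ^ m - 1)), β (traceWord (2 ^ m - 1) ξ T (a + 2 * b) e p) =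
      Q m (ρ a * point (ρ ξ) p) + tr (ρ b * point (ρ ξ) p) + β e +
        red e * tr (ρ a * point (ρ ξ) p) := by
    intro p
    rw [hlin, β_add_two_mul_add, H.β_trace hT hm (ha.mul (isTeichmuller_teichPoint ξ p)),
      H.red_trace hT, H.red_trace hT, map_mul, map_mul, map_teichPoint]
  have hred : ∀ p : Option (Fin (2 ^ m - 1)), red (traceWord (2 ^ m - 1) ξ T (a + 2 * b) e p) =
      tr (ρ a * point (ρ ξ) p) + red e := by
    intro p
    rw [hlin, map_add, map_add, map_mul red, show red 2 = 0 from rfl, zero_mul, add_zero,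
      H.red_trace hT, map_mul, map_teichPoint]
  funext s
  rcases s with p | p
  · change β _ = kerdockWord _ _ _ _ _ (point (ρ ξ) p, 0)
    rw [hβ, kerdockWord]
    simp only [add_mul, tr_add, mul_assoc, tr_algebraMap_mul]
    ring
  · change γ _ = kerdockWord _ _ _ _ _ (point (ρ ξ) p, 1)
    rw [γ_eq, hβ, hred, kerdockWord]
    simp only [add_mul, tr_add, mul_assoc, tr_algebraMap_mul]
    ring

theorem gray_image_traceWord (H : IsGaloisRing m ρ ξ σ) (hT : IsTrace m σ T) (hm : Odd m) :
    gray '' Set.range (fun le : R × ZMod 4 => traceWord (2 ^ m - 1) ξ T le.1 le.2) =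
      {v | ∃ w ∈ kerdockCode F m, v = w ∘ binaryPoint (ρ ξ)} := by
  ext v
  constructor
  · rintro ⟨_, ⟨⟨l, e⟩, rfl⟩, rfl⟩
    obtain ⟨a, b, ha, -, rfl⟩ := H.exists_expansion l
    exact ⟨_, mem_kerdockCode_iff.2 ⟨_, _, _, _, rfl⟩, H.gray_traceWord hT hm ha b e⟩
  · rintro ⟨w, hw, rfl⟩
    obtain ⟨π, η, A, B, rfl⟩ := mem_kerdockCode_iff.1 hw
    obtain ⟨e, rfl, rfl⟩ := exists_red_β A B
    obtain ⟨a, ha, rfl⟩ := H.exists_teichmuller π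
    obtain ⟨b, hb⟩ := H.map_surjective (η - algebraMap (ZMod 2) F (red e) * ρ a)
    refine ⟨_, ⟨(a + 2 * b, e), rfl⟩, ?_⟩
    rw [H.gray_traceWord hT hm ha b e, hb, sub_add_cancel]

end IsGaloisRing

/-! ### The trace words exhaust the quaternary code. -/

instance : Nontrivial (ZMod 4) := ⟨0, 1, by decide⟩

theorem card_adjoinRoot {h : (ZMod 4)[X]} (hmon : h.Monic) :
    Nat.card (AdjoinRoot h) = 4 ^ h.natDegree := by
  rw [Nat.card_congr (AdjoinRoot.powerBasis' hmon).basis.equivFun.toEquiv, Nat.card_fun,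
    Nat.card_fin, Nat.card_zmod, AdjoinRoot.powerBasis'_dim]

section

variable {m : ℕ} {h₂ : (ZMod 2)[X]} {h : (ZMod 4)[X]} {F : Type*} [Field F] [Algebra (ZMod 2) F]
  {ρ : AdjoinRoot h →+* F} {σ : AdjoinRoot h →ₐ[ZMod 4] AdjoinRoot h}
  {T : AdjoinRoot h →ₗ[ZMod 4] ZMod 4}

theorem monic_X_sub_one_mul (hmon : h.Monic) : ((X - 1) * h).Monic :=
  (monic_X_sub_C (1 : ZMod 4)).mul hmon

theorem natDegree_X_sub_one_mul (hmon : h.Monic) : ((X - 1) * h).natDegree = h.natDegree + 1 := by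
  rw [← C_1, (monic_X_sub_C (1 : ZMod 4)).natDegree_mul hmon, natDegree_X_sub_C, add_comm]

theorem mul_divByMonic_eq {n : ℕ} (hmon : h.Monic) (hdvd : (X - 1) * h ∣ X ^ n - 1) :
    (X - 1) * h * ((X ^ n - 1) /ₘ ((X - 1) * h)) = X ^ n - 1 := by
  have := modByMonic_add_div (X ^ n - 1) ((X - 1) * h)
  rwa [(modByMonic_eq_zero_iff_dvd (monic_X_sub_one_mul hmon)).2 hdvd, zero_add] at this

theorem traceWord_mem (H : IsGaloisRing m ρ (AdjoinRoot.root h) σ) (hmon : h.Monic)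
    (hdvd : (X - 1) * h ∣ X ^ (2 ^ m - 1) - 1) (l : AdjoinRoot h) (e : ZMod 4) :
    traceWord (2 ^ m - 1) (AdjoinRoot.root h) T l e ∈ quaternaryCode m h := by
  have hn : 2 ^ m - 1 ≠ 0 := by have := H.three_le; omega
  refine ⟨?_, H.sum_traceWord l e⟩
  have hP := monic_X_sub_one_mul hmon
  have hq := mul_divByMonic_eq hmon hdvd
  -- The word is a sum of two: the part in `l` comes from the root `ξ` of `h`, the constant `e` from
  -- the root 1 of `X - 1`.
  have h1 := mem_cyclicCode_of_aeval_eq_zero hn hP hq (b := AdjoinRoot.root h) H.pow_eq_one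
    (by rw [map_mul, AdjoinRoot.aeval_eq h, AdjoinRoot.mk_self, mul_zero])
    (T.comp (LinearMap.mulLeft (ZMod 4) l))
  have h2 := mem_cyclicCode_of_aeval_eq_zero hn hP hq (b := (1 : ZMod 4)) (one_pow _)
    (by simp) (LinearMap.mulLeft (ZMod 4) e)
  have := Submodule.add_mem _ h1 h2
  simpa [traceWord, teichPoint, Pi.add_def, generator] using this

theorem card_quaternaryCode_le (hm : 2 ≤ m) (hlift : IsHenselLift m h₂ h)
    (hdvd : (X - 1) * h ∣ X ^ (2 ^ m - 1) - 1) :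
    Nat.card (quaternaryCode m h) ≤ 4 ^ (m + 1) := by
  have hn : 2 ^ m - 1 ≠ 0 := (odd_two_pow_sub_one (by omega)).pos.ne'
  refine (card_extendedCode_le _).trans ((card_cyclicCode_le hn (monic_X_sub_one_mul hlift.1)
    (mul_divByMonic_eq hlift.1 hdvd)).trans ?_)
  rw [natDegree_X_sub_one_mul hlift.1, hlift.2.1, Nat.card_zmod]

theorem traceWord_bijective (H : IsGaloisRing m ρ (AdjoinRoot.root h) σ)
    (hT : IsGaloisRing.IsTrace m σ T)
    (hlift : IsHenselLift m h₂ h) (hdvd : (X - 1) * h ∣ X ^ (2 ^ m - 1) - 1) :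
    Function.Bijective (fun le : AdjoinRoot h × ZMod 4 =>
      (⟨traceWord (2 ^ m - 1) (AdjoinRoot.root h) T le.1 le.2,
        traceWord_mem H hlift.1 hdvd le.1 le.2⟩ : quaternaryCode m h)) := by
  apply Function.Injective.bijective_of_nat_card_le
  · intro x y hxy
    exact H.traceWord_injective hT (congrArg Subtype.val hxy)
  · rw [Nat.card_prod, card_adjoinRoot hlift.1, hlift.2.1, Nat.card_zmod, ← pow_succ]
    exact card_quaternaryCode_le H.two_le hlift hdvd

theorem range_traceWord (H : IsGaloisRing m ρ (AdjoinRoot.root h) σ)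
    (hT : IsGaloisRing.IsTrace m σ T)
    (hlift : IsHenselLift m h₂ h) (hdvd : (X - 1) * h ∣ X ^ (2 ^ m - 1) - 1) :
    (quaternaryCode m h : Set (Option (Fin (2 ^ m - 1)) → ZMod 4)) =
      Set.range fun le : AdjoinRoot h × ZMod 4 =>
        traceWord (2 ^ m - 1) (AdjoinRoot.root h) T le.1 le.2 := by
  ext w
  constructor
  · intro hw
    obtain ⟨le, hle⟩ := (traceWord_bijective H hT hlift hdvd).2 ⟨w, hw⟩
    exact ⟨le, congrArg Subtype.val hle⟩
  · rintro ⟨le, rfl⟩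
    exact traceWord_mem H hlift.1 hdvd le.1 le.2

theorem ncard_quaternaryCode (H : IsGaloisRing m ρ (AdjoinRoot.root h) σ)
    (hT : IsGaloisRing.IsTrace m σ T)
    (hlift : IsHenselLift m h₂ h) (hdvd : (X - 1) * h ∣ X ^ (2 ^ m - 1) - 1) :
    (quaternaryCode m h : Set (Option (Fin (2 ^ m - 1)) → ZMod 4)).ncard = 4 ^ (m + 1) := by
  have := Nat.card_congr (Equiv.ofBijective _ (traceWord_bijective H hT hlift hdvd))
  rw [Nat.card_prod, card_adjoinRoot hlift.1, hlift.2.1, Nat.card_zmod, ← pow_succ] at this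
  exact this.symm

end

/-! ### Polarization of the Kerdock functions. -/

section QuadraticForm

theorem pow_two_pow_eq {F : Type*} [Field F] {m : ℕ} (hF : Nat.card F = 2 ^ m) (x : F) :
    x ^ 2 ^ m = x := by
  have : Finite F := Nat.finite_of_card_ne_zero (by rw [hF]; positivity)
  have := Fintype.ofFinite F
  rw [← hF, Nat.card_eq_fintype_card]
  exact FiniteField.pow_card x

theorem charP_two (F : Type*) [Field F] [Algebra (ZMod 2) F] : CharP F 2 :=
  charP_of_injective_algebraMap (algebraMap (ZMod 2) F).injective 2

variable {F : Type*} [Field F] [Algebra (ZMod 2) F] {m : ℕ}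

theorem tr_sq (hF : Nat.card F = 2 ^ m) (x : F) : tr (x ^ 2) = tr x := by
  have := charP_two F
  have h2 : ∀ c : ZMod 2, c ^ 2 = c := by decide
  apply (algebraMap (ZMod 2) F).injective
  rw [← h2 (tr x), map_pow, algebraMap_tr hF, algebraMap_tr hF, sum_pow_char]
  exact Finset.sum_congr rfl fun i _ => pow_right_comm _ _ _

theorem tr_pow_two_pow (hF : Nat.card F = 2 ^ m) (x : F) (i : ℕ) : tr (x ^ 2 ^ i) = tr x := by
  induction i with
  | zero => simp
  | succ i ih => rw [pow_succ, pow_mul, tr_sq hF, ih]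

theorem tr_mul_tr (hF : Nat.card F = 2 ^ m) (x y : F) :
    tr x * tr y = ∑ i ∈ Finset.range m, tr (x * y ^ 2 ^ i) := by
  rw [mul_comm, ← tr_algebraMap_mul, algebraMap_tr hF, mul_comm, Finset.mul_sum]
  exact map_sum (Algebra.trace (ZMod 2) F) _ _

/-- The polarization of `Q`. -/
theorem Q_add (hF : Nat.card F = 2 ^ m) (hm : Odd m) (x y : F) :
    Q m (x + y) = Q m x + Q m y + (tr x * tr y + tr (x * y)) := by
  have := charP_two F
  have hpow : ∀ z : F, z ^ 2 ^ m = z := pow_two_pow_eq hF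
  have htr : ∀ (z : F) (i : ℕ), tr (z ^ 2 ^ i) = tr z := tr_pow_two_pow hF
  have hmul := tr_mul_tr hF x y
  obtain ⟨k, rfl⟩ := hm
  have hk : (2 * k + 1 - 1) / 2 = k := by omega
  rw [sum_range_two_mul_add_one, pow_zero, pow_one] at hmul
  -- Frobenius invariance of the trace turns `x ^ 2 ^ d * y` into `x * y ^ 2 ^ (m - d)`. All nonzero
  -- exponents in `tr x * tr y = ∑ tr(x * y ^ 2 ^ i)` then occur; the missing term `i = 0` is `tr (x
  -- * y)`.
  have hcross : ∑ d ∈ Finset.Icc 1 k, (tr (x * y ^ 2 ^ d) + tr (x ^ 2 ^ d * y)) =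
      tr x * tr y + tr (x * y) := by
    have h2 : tr (x * y) + tr (x * y) = 0 := CharTwo.add_self_eq_zero _
    have h3 : ∑ d ∈ Finset.Icc 1 k, (tr (x * y ^ 2 ^ d) + tr (x ^ 2 ^ d * y)) =
        ∑ d ∈ Finset.Icc 1 k, (tr (x * y ^ 2 ^ d) + tr (x * y ^ 2 ^ (2 * k + 1 - d))) := by
      refine Finset.sum_congr rfl fun d hd => ?_
      have hd' := Finset.mem_Icc.1 hd
      rw [← htr (x ^ 2 ^ d * y) (2 * k + 1 - d), mul_pow, ← pow_mul x, ← pow_add,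
        show d + (2 * k + 1 - d) = 2 * k + 1 by omega, hpow]
    rw [h3]
    linear_combination -hmul - h2
  rw [← hcross, Q, Q, Q, hk, ← Finset.sum_add_distrib, ← Finset.sum_add_distrib]
  refine Finset.sum_congr rfl fun d _ => ?_
  rw [pow_add, pow_one, add_pow_char_pow, show (x + y) * (x ^ 2 ^ d + y ^ 2 ^ d) =
    x ^ (1 + 2 ^ d) + y ^ (1 + 2 ^ d) + (x * y ^ 2 ^ d + x ^ 2 ^ d * y) by ring]
  simp only [tr_add]

theorem Q_zero : Q m (0 : F) = 0 := by
  simp [Q, tr_zero]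

theorem tr_one (hF : Nat.card F = 2 ^ m) (hm : Odd m) : tr (1 : F) = 1 := by
  have := Algebra.trace_algebraMap (S := F) (1 : ZMod 2)
  rw [map_one, finrank_eq_of_card hF] at this
  rw [tr, this, nsmul_eq_mul, mul_one]
  exact ZMod.natCast_eq_one_iff_odd.2 hm

/-- The polarization of `q_π`. -/
noncomputable def kerdockForm (π : F) (u v : F × ZMod 2) : ZMod 2 :=
  tr (π * u.1) * tr (π * v.1) + tr (π * u.1 * (π * v.1)) + u.2 * tr (π * v.1) + v.2 * tr (π * u.1)

theorem kerdockWord_add (hF : Nat.card F = 2 ^ m) (hm : Odd m) (π η : F) (A B : ZMod 2)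
    (u v : F × ZMod 2) : kerdockWord m π η A B (u + v) =
      kerdockWord m π η A B u + kerdockWord m π η A B v + kerdockWord m π η A B 0 +
        kerdockForm π u v := by
  simp only [kerdockWord, kerdockForm, Prod.fst_add, Prod.snd_add, Prod.fst_zero, Prod.snd_zero,
    mul_add, mul_zero, Q_add hF hm, tr_add, tr_zero, Q_zero]
  linear_combination (-B) * two_eq_zero (ZMod 2)

theorem kerdockForm_add_left (π : F) (u u' v : F × ZMod 2) :
    kerdockForm π (u + u') v = kerdockForm π u v + kerdockForm π u' v := by
  simp only [kerdockForm, Prod.fst_add, Prod.snd_add, mul_add, add_mul, tr_add]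
  ring

/-- Pairing `(y, c)` with `(0, 1)` gives `tr(π y) = 0`; pairing with all `(x, 0)` then gives `π y =
c`. Taking traces, `c = 0` because `tr 1 = 1` for odd `m`. -/
theorem kerdockForm_nondegenerate (hF : Nat.card F = 2 ^ m) (hm : Odd m) {π : F} (hπ : π ≠ 0)
    {v : F × ZMod 2} (hv : ∀ u, kerdockForm π u v = 0) : v = 0 := by
  have : Finite F := Nat.finite_of_card_ne_zero (by rw [hF]; positivity)
  have := charP_two F
  obtain ⟨y, c⟩ := v
  have h1 : tr (π * y) = 0 := by simpa [kerdockForm, tr_zero] using hv (0, 1)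
  have h2 : π * y + algebraMap (ZMod 2) F c = 0 := by
    by_contra hne
    obtain ⟨x, hx⟩ := IsGaloisRing.exists_tr_ne_zero hne
    have h3 := hv (π⁻¹ * x, 0)
    simp only [kerdockForm, mul_inv_cancel_left₀ hπ, h1, mul_zero, zero_add, add_zero] at h3
    rw [add_mul, tr_add, tr_algebraMap_mul, mul_comm (π * y) x, h3] at hx
    exact hx rfl
  have h4 : c = 0 := by
    have := congrArg tr h2
    rw [tr_add, h1, zero_add, ← mul_one (algebraMap _ _ c), tr_algebraMap_mul, tr_one hF hm,
      mul_one, tr_zero] at this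
    exact this
  subst h4
  rw [map_zero, add_zero] at h2
  rw [(mul_eq_zero.1 h2).resolve_left hπ]
  rfl

end QuadraticForm

/-! ### Character sums of quadratic Boolean functions. -/

section CharacterSums

/-- The sign character of `ℤ/2`. -/
def sign (a : ZMod 2) : ℤ := if a = 0 then 1 else -1

theorem sign_add (a b : ZMod 2) : sign (a + b) = sign a * sign b := by revert a b; decide

theorem sign_mul_self (a : ZMod 2) : sign a * sign a = 1 := by revert a; decide

variable {G : Type*} [AddCommGroup G] [Fintype G]

theorem sum_sign_eq_zero {L : G → ZMod 2} (hL : ∀ u v, L (u + v) = L u + L v) {u : G}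
    (hu : L u ≠ 0) : ∑ x, sign (L x) = 0 := by
  have h1 : sign (L u) = -1 := if_neg hu
  have h2 : ∑ x, sign (L (x + u)) = ∑ x, sign (L x) :=
    Equiv.sum_comp (Equiv.addRight u) fun x => sign (L x)
  simp only [hL, sign_add, h1, ← Finset.sum_mul] at h2
  linarith

/-- A quadratic Boolean function whose polarization is nondegenerate is bent. -/
theorem sum_sign_sq_eq_card {f : G → ZMod 2} {B : G → G → ZMod 2}
    (hf : ∀ u v, f (u + v) = f u + f v + f 0 + B u v)
    (hB : ∀ u u' v, B (u + u') v = B u v + B u' v) (hnd : ∀ v, (∀ u, B u v = 0) → v = 0) :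
    (∑ x, sign (f x)) ^ 2 = Fintype.card G := by
  classical
  have h1 : (∑ x, sign (f x)) ^ 2 =
      ∑ v, sign (f v) * sign (f 0) * ∑ u, sign (B u v) := by
    rw [sq, Finset.sum_mul_sum]
    simp only [Finset.mul_sum]
    rw [Finset.sum_comm (f := fun v u => sign (f v) * sign (f 0) * sign (B u v))]
    refine Finset.sum_congr rfl fun u _ => ?_
    -- With second variable `u + v`, the factor `sign (f u)` occurs twice and cancels. The inner sum
    -- over `u` is then that of an additive character, zero unless `v = 0`.
    rw [← Equiv.sum_comp (Equiv.addLeft u)]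
    refine Finset.sum_congr rfl fun v _ => ?_
    simp only [Equiv.coe_addLeft, hf, sign_add]
    linear_combination sign (f v) * sign (f 0) * sign (B u v) * sign_mul_self (f u)
  rw [h1, Finset.sum_eq_single 0]
  · have h0 : ∀ u, B u 0 = 0 := fun u => by
      have := hf u 0
      rw [add_zero] at this
      linear_combination -this - f 0 * two_eq_zero (ZMod 2)
    rw [sign_mul_self, one_mul]
    simp [h0, sign]
  · intro v _ hv
    have : ∃ u, B u v ≠ 0 := by
      by_contra! h
      exact hv (hnd v h)
    obtain ⟨u, hu⟩ := this
    rw [sum_sign_eq_zero (L := fun u => B u v) (fun x y => hB x y v) hu, mul_zero]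
  · exact fun h => absurd (Finset.mem_univ 0) h

theorem sum_sign_eq {ι : Type*} [Fintype ι] (w : ι → ZMod 2) :
    ∑ i, sign (w i) = Fintype.card ι - 2 * (hammingNorm w : ℤ) := by
  have : ∀ a : ZMod 2, sign a = 1 - 2 * if a ≠ 0 then 1 else 0 := by decide
  simp only [this, Finset.sum_sub_distrib, ← Finset.mul_sum, Finset.sum_boole, hammingNorm]
  simp

end CharacterSums

/-! ### Weights of Kerdock functions and the minimal distance. -/

section Distance

variable {ι : Type*}

theorem gray_injective : Function.Injective (gray : (ι → ZMod 4) → ι ⊕ ι → ZMod 2) := by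
  intro a b hab
  funext i
  have key : ∀ x y : ZMod 4, β x = β y → γ x = γ y → x = y := by decide
  exact key _ _ (congrFun hab (Sum.inl i)) (congrFun hab (Sum.inr i))

/-- The Gray map is an isometry: it turns differences into Hamming distances. -/
theorem hammingDist_gray [Fintype ι] (a b : ι → ZMod 4) :
    hammingDist (gray a) (gray b) = hammingNorm (gray (a - b)) := by
  have key : ∀ x y : ZMod 4, ((if β x ≠ β y then 1 else 0) + if γ x ≠ γ y then 1 else 0) =
      (if β (x - y) ≠ 0 then 1 else 0) + if γ (x - y) ≠ 0 then 1 else 0 := by decide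
  simp only [hammingDist, hammingNorm, Finset.card_filter, Fintype.sum_sum_type,
    ← Finset.sum_add_distrib]
  exact Finset.sum_congr rfl fun i _ => key _ _

theorem card_prod_zmod_two {F : Type*} [Fintype F] {m : ℕ} (hF : Nat.card F = 2 ^ m) :
    (Fintype.card (F × ZMod 2) : ℤ) = 2 ^ (m + 1) := by
  rw [Fintype.card_prod, ← Nat.card_eq_fintype_card, hF, ZMod.card, pow_succ]
  push_cast
  rfl

theorem hammingNorm_comp [Fintype ι] {F : Type*} [Fintype F] {m : ℕ}
    (hF : Nat.card F = 2 ^ m) {e : ι → F × ZMod 2}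
    (he : Function.Bijective e) (w : F × ZMod 2 → ZMod 2) :
    ∑ z, sign (w z) = 2 ^ (m + 1) - 2 * (hammingNorm (w ∘ e) : ℤ) := by
  rw [← card_prod_zmod_two hF, ← Fintype.card_of_bijective he, ← sum_sign_eq]
  exact (he.sum_comp fun z => sign (w z)).symm

variable {F : Type*} [Field F] [Algebra (ZMod 2) F] [Fintype F] {m : ℕ}

theorem sum_sign_kerdockWord_sq (hF : Nat.card F = 2 ^ m) (hm : Odd m) {π : F} (hπ : π ≠ 0)
    (η : F) (A B : ZMod 2) : (∑ z, sign (kerdockWord m π η A B z)) ^ 2 = 2 ^ (m + 1) := by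
  rw [sum_sign_sq_eq_card (kerdockWord_add hF hm π η A B) (kerdockForm_add_left π)
    (fun v hv => kerdockForm_nondegenerate hF hm hπ hv), card_prod_zmod_two hF]

theorem sum_sign_kerdockWord_zero (hF : Nat.card F = 2 ^ m) (η : F) (A B : ZMod 2) :
    ∑ z, sign (kerdockWord m (0 : F) η A B z) ≤ 0 ∨
      ∑ z, sign (kerdockWord m (0 : F) η A B z) = 2 ^ (m + 1) := by
  have hw : ∀ z, kerdockWord m (0 : F) η A B z = (tr (η * z.1) + A * z.2) + B := fun z => by
    simp [kerdockWord, Q_zero, tr_zero]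
  have hL : ∀ u v : F × ZMod 2, tr (η * (u + v).1) + A * (u + v).2 =
      (tr (η * u.1) + A * u.2) + (tr (η * v.1) + A * v.2) := fun u v => by
    rw [Prod.fst_add, Prod.snd_add, mul_add, mul_add, tr_add]
    ring
  simp only [hw, sign_add _ B, ← Finset.sum_mul]
  by_cases h : ∃ u : F × ZMod 2, tr (η * u.1) + A * u.2 ≠ 0
  · obtain ⟨u, hu⟩ := h
    left
    rw [sum_sign_eq_zero (L := fun z : F × ZMod 2 => tr (η * z.1) + A * z.2) hL hu, zero_mul]
  · push Not at h
    simp only [h, sign, if_true, Finset.sum_const, Finset.card_univ, nsmul_eq_mul, mul_one,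
      card_prod_zmod_two hF]
    split_ifs
    · exact Or.inr (mul_one _)
    · left
      have : (0 : ℤ) < 2 ^ (m + 1) := by positivity
      linarith

/-- The second alternative is the zero function: the sum equals `2 ^ (m + 1)` minus twice the
weight. -/
theorem sum_sign_kerdockWord_le (hF : Nat.card F = 2 ^ m) (hm : Odd m) (π η : F) (A B : ZMod 2) :
    ∑ z, sign (kerdockWord m π η A B z) ≤ 2 ^ ((m + 1) / 2) ∨
      ∑ z, sign (kerdockWord m π η A B z) = 2 ^ (m + 1) := by
  by_cases hπ : π = 0
  · subst hπ
    exact (sum_sign_kerdockWord_zero hF η A B).imp_left fun h => h.trans (by positivity)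
  · left
    have h := sum_sign_kerdockWord_sq hF hm hπ η A B
    obtain ⟨k, rfl⟩ := hm
    rw [show 2 * k + 1 + 1 = (k + 1) * 2 by ring, pow_mul] at h
    rw [show (2 * k + 1 + 1) / 2 = k + 1 by omega]
    exact (abs_le_of_sq_le_sq' h.le (by positivity)).2

/-- Adding the constant 1 changes the sign of the sum, so the positive square root is attained. -/
theorem exists_sum_sign_kerdockWord_eq (hF : Nat.card F = 2 ^ m) (hm : Odd m) :
    ∃ B, ∑ z, sign (kerdockWord m (1 : F) 0 0 B z) = 2 ^ ((m + 1) / 2) := by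
  have h := sum_sign_kerdockWord_sq hF hm (one_ne_zero (α := F)) 0 0 0
  have hneg : ∑ z, sign (kerdockWord m (1 : F) 0 0 1 z) =
      -∑ z, sign (kerdockWord m (1 : F) 0 0 0 z) := by
    rw [← Finset.sum_neg_distrib]
    refine Finset.sum_congr rfl fun z _ => ?_
    have : kerdockWord m (1 : F) 0 0 1 z = kerdockWord m (1 : F) 0 0 0 z + 1 := by
      simp only [kerdockWord]; ring
    rw [this, sign_add]
    simp [sign]
  obtain ⟨k, rfl⟩ := hm
  rw [show 2 * k + 1 + 1 = (k + 1) * 2 by ring, pow_mul, sq_eq_sq_iff_eq_or_eq_neg] at h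
  rw [show (2 * k + 1 + 1) / 2 = k + 1 by omega]
  rcases h with h | h
  · exact ⟨0, h⟩
  · exact ⟨1, by rw [hneg, h, neg_neg]⟩

/-- The minimal distance of the Gray image of a quaternary linear code which is the Kerdock code. -/
theorem isMinimalDistance_gray_image [Fintype ι] (hF : Nat.card F = 2 ^ m) (hm : Odd m)
    {e : ι ⊕ ι → F × ZMod 2} (he : Function.Bijective e) (D : Submodule (ZMod 4) (ι → ZMod 4))
    (hD : gray '' (D : Set (ι → ZMod 4)) = {v | ∃ w ∈ kerdockCode F m, v = w ∘ e}) :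
    IsMinimalDistance (gray '' (D : Set (ι → ZMod 4))) (2 ^ m - 2 ^ ((m - 1) / 2)) := by
  have hpow : (2 : ℤ) ^ ((m + 1) / 2) = 2 * 2 ^ ((m - 1) / 2) := by
    obtain ⟨k, rfl⟩ := hm
    rw [show (2 * k + 1 + 1) / 2 = k + 1 by omega, show (2 * k + 1 - 1) / 2 = k by omega, pow_succ']
  have hlt : 2 ^ ((m - 1) / 2) < 2 ^ m :=
    Nat.pow_lt_pow_right (by norm_num) (by have := hm.pos; omega)
  have hcast : ((2 ^ m - 2 ^ ((m - 1) / 2) : ℕ) : ℤ) = 2 ^ m - 2 ^ ((m - 1) / 2) := by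
    push_cast [Nat.cast_sub hlt.le]
    rfl
  have hm1 : (2 : ℤ) ^ (m + 1) = 2 * 2 ^ m := pow_succ' _ _
  constructor
  · obtain ⟨B, hB⟩ := exists_sum_sign_kerdockWord_eq hF hm
    have hv : kerdockWord m (1 : F) 0 0 B ∘ e ∈ gray '' (D : Set (ι → ZMod 4)) := by
      rw [hD]
      exact ⟨_, mem_kerdockCode_iff.2 ⟨_, _, _, _, rfl⟩, rfl⟩
    obtain ⟨a, ha, hav⟩ := hv
    have hdist : hammingDist (gray a) (gray 0) = 2 ^ m - 2 ^ ((m - 1) / 2) := by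
      rw [hammingDist_gray, sub_zero, hav]
      have := hammingNorm_comp hF he (kerdockWord m (1 : F) 0 0 B)
      zify
      rw [hcast]
      linarith
    refine ⟨gray a, ⟨a, ha, rfl⟩, gray 0, ⟨0, D.zero_mem, rfl⟩, ?_, hdist⟩
    rw [← hammingDist_pos, hdist]
    omega
  · rintro k ⟨_, ⟨a, ha, rfl⟩, _, ⟨b, hb, rfl⟩, hne, rfl⟩
    -- Linearity over `ℤ/4` enters here: the binary code need not be closed under differences, but
    -- `a - b` again has a Kerdock function as Gray image.
    have hab : gray (a - b) ∈ gray '' (D : Set (ι → ZMod 4)) := ⟨_, D.sub_mem ha hb, rfl⟩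
    rw [hD] at hab
    obtain ⟨w, hw, hwe⟩ := hab
    obtain ⟨π, η, A, B, rfl⟩ := mem_kerdockCode_iff.1 hw
    have hpos := hammingDist_pos.2 hne
    rw [hammingDist_gray, hwe] at hpos ⊢
    have hsum := hammingNorm_comp hF he (kerdockWord m π η A B)
    zify
    rw [hcast]
    rcases sum_sign_kerdockWord_le hF hm π η A B with h | h
    · linarith
    · zify at hpos
      linarith

end Distance

end Z4Code

/-! ### Assembly of the theorem. -/

theorem theorem5 (m : ℕ) (hm : 2 ≤ m) (h₂ : Polynomial (ZMod 2))
    (hprim : Z4Code.IsPrimitiveBinary h₂) (hdeg : h₂.natDegree = m)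
    (h : Polynomial (ZMod 4)) (hlift : Z4Code.IsHenselLift m h₂ h) :
    -- the quotient whose reciprocal is the generator is an exact one
    (Polynomial.X - 1) * h ∣ Polynomial.X ^ (2 ^ m - 1) - 1 ∧
    -- length and size of the quaternary code
    Z4Code.codeLength
      (Z4Code.quaternaryCode m h : Set (Option (Fin (2 ^ m - 1)) → ZMod 4)) = 2 ^ m ∧
    (Z4Code.quaternaryCode m h : Set (Option (Fin (2 ^ m - 1)) → ZMod 4)).ncard = 4 ^ (m + 1) ∧
    (Odd m → 3 ≤ m →
      -- the binary image is the Kerdock code, its coordinates being labelled by the points of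
      -- `F × 𝔽₂` by means of any root `θ` of `h₂` in the field `F` with `2 ^ m` elements
      (∃ θ : GaloisField 2 m, Polynomial.aeval θ h₂ = 0) ∧
      (∀ θ : GaloisField 2 m, Polynomial.aeval θ h₂ = 0 →
        Function.Bijective (Z4Code.binaryPoint θ (n := 2 ^ m - 1)) ∧
        Z4Code.binaryCode m h =
          {v | ∃ w ∈ Z4Code.kerdockCode (GaloisField 2 m) m, v = w ∘ Z4Code.binaryPoint θ}) ∧
      -- its length, size and minimal distance
      Z4Code.codeLength (Z4Code.binaryCode m h) = 2 ^ (m + 1) ∧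
      (Z4Code.binaryCode m h).ncard = 2 ^ (2 * m + 2) ∧
      Z4Code.IsMinimalDistance (Z4Code.binaryCode m h) (2 ^ m - 2 ^ ((m - 1) / 2))) := by
  have hF : Nat.card (GaloisField 2 m) = 2 ^ m := GaloisField.card 2 m (by omega)
  have := Fintype.ofFinite (GaloisField 2 m)
  have hdvd := Z4Code.X_sub_one_mul_dvd hm hprim hdeg hlift
  have hlen : Fintype.card (Option (Fin (2 ^ m - 1))) = 2 ^ m := by
    rw [Fintype.card_option, Fintype.card_fin, Nat.sub_add_cancel Nat.one_le_two_pow]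
  have hroot : ∃ θ : GaloisField 2 m, Polynomial.aeval θ h₂ = 0 := by
    refine Z4Code.exists_root_of_dvd hF (by omega) ?_
    have h1 := Polynomial.map_dvd Z4Code.red hlift.2.2.2
    rw [hlift.2.2.1] at h1
    simpa using h1
  have hsize : (Z4Code.quaternaryCode m h :
      Set (Option (Fin (2 ^ m - 1)) → ZMod 4)).ncard = 4 ^ (m + 1) := by
    obtain ⟨θ, hθ⟩ := hroot
    -- The size does not involve `θ`; a root is needed only to define the residue map.
    obtain ⟨σ, H⟩ := Z4Code.exists_isGaloisRing hF hm hprim hdeg hlift hθ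
    obtain ⟨T, hT⟩ := H.exists_trace
    exact Z4Code.ncard_quaternaryCode H hT hlift hdvd
  have hkerdock : Odd m → ∀ θ : GaloisField 2 m, Polynomial.aeval θ h₂ = 0 →
      Function.Bijective (Z4Code.binaryPoint θ (n := 2 ^ m - 1)) ∧
      Z4Code.binaryCode m h =
        {v | ∃ w ∈ Z4Code.kerdockCode (GaloisField 2 m) m, v = w ∘ Z4Code.binaryPoint θ} := by
    intro hodd θ hθ
    obtain ⟨σ, H⟩ := Z4Code.exists_isGaloisRing hF hm hprim hdeg hlift hθ
    obtain ⟨T, hT⟩ := H.exists_trace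
    have h1 := H.binaryPoint_bijective
    have h2 := H.gray_image_traceWord hT hodd
    rw [← Z4Code.range_traceWord H hT hlift hdvd] at h2
    rw [Z4Code.residue_root] at h1 h2
    exact ⟨h1, h2⟩
  refine ⟨hdvd, hlen, hsize, fun hodd _ => ⟨hroot, hkerdock hodd, ?_, ?_, ?_⟩⟩
  · rw [Z4Code.codeLength, Fintype.card_sum, hlen, pow_succ, mul_two]
  · rw [Z4Code.binaryCode, Set.ncard_image_of_injective _ Z4Code.gray_injective, hsize,
      show 4 = 2 ^ 2 by norm_num, ← pow_mul, mul_add_one]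
  · obtain ⟨θ, hθ⟩ := hroot
    obtain ⟨hbij, hcode⟩ := hkerdock hodd θ hθ
    exact Z4Code.isMinimalDistance_gray_image hF hodd hbij _ hcode
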